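/- **Setting.** Let $y = X\beta^* + \varepsilon$ with $\beta^*\in\mathbb{R}^p$, $\beta^*\neq 0$, $S^*=\mathrm{supp}(\beta^*)$, $s=|S^*|$, and let $Z = X + A$ be observed, where $X, A\in\mathbb{R}^{n\times p}$ and $\varepsilon\in\mathbb{R}^n$ are independent ($X$ may be deterministic). The columns of $X$ are normalized, $\|X_j\|^2\le n$. The rows of $A$ are i.i.d. with mean zero, known covariance matrix $\Sigma_A\neq 0$ and sub-Gaussian parameter $\tau^2$. The entries of $\varepsilon$ are i.i.d. with $\mathbb{E}\,e^{t\varepsilon_i}\le e^{\sigma^2t^2/2}$ for all $t\in\mathbb{R}$, where $\sigma>0$. Put $\Sigma=\frac1n X^\top X$, $\widehat\Sigma=\frac1nZ^\top Z-\Sigma_A$ and $\widehat\xi=\frac1nZ^\top y$. Fix $\hat\epsilon>0$. With an eigenvalue decomposition $\widehat\Sigma=P\,\mathrm{Diag}(\theta)P^\top$ and $m_i=\max(\theta_i,\hat\epsilon)$, let $$\widetilde\Sigma=P\,\mathrm{Diag}(m)P^\top,\quad \widetilde Z=\sqrt n\,P\,\mathrm{Diag}(\sqrt m)P^\top,\quad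 \widetilde y=\sqrt n\,P\,\mathrm{Diag}(1/\sqrt m)P^\top\widehat\xi .$$ **Algorithm.** Let $a>1$, $\phi(t)=\frac{a-1}{a+1}t^2+\frac{2}{a+1}t$, $\lambda>0$, $\rho_0=1$ and $w^0\in[0,\frac12]^p$. For $k=1,2,\dots$ let $\beta^k$ be a minimizer over $\beta\in\mathbb{R}^p$ of $$\frac{1}{2n}\|\widetilde Z\beta-\widetilde y\|^2+\lambda\sum_{i=1}^p(1-w_i^{k-1})|\beta_i| ;$$ choose $\rho_k\ge\rho_{k-1}$ if $k\le3$ and $\rho_k=\rho_{k-1}$ if $k>3$; and let $w_i^k$ be the minimizer of $\phi(t)-\rho_k t|\beta_i^k|$ over $t\in[0,1]$. Let $\beta^{\rm LS}$ be the minimizer of $\|\widetilde Z\beta-\widetilde y\|^2$ subject to $\mathrm{supp}(\beta)\subseteq S^*$. **Constants.** With $\|\cdot\|_{\max}$ the largest absolute value of an entry, let $K=2(\lambda_{\max}(\Sigma_A)+\hat\epsilon)\|\beta^*\|_1$, $\widetilde G=\widetilde\Sigma_{(S^*)^cS^*}\widetilde\Sigma_{S^*S^*}^{-1}$, $K'=K\max(2,1+s\|\widetilde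 G\|_{\max})$ and $K''=Ks\|\widetilde\Sigma_{S^*S^*}^{-1}\|_{\max}$. **Statement.** There are universal constants $C,c>0$ and a positive function $\zeta$ of $\beta^*,\tau^2,\sigma^2,\kappa$ and $\lambda_{\max}(\Sigma_A)$ only (with $\beta^*$ entering through its zero-padded sequence of entries, so that $\zeta$ does not depend on $p$ otherwise) such that the following holds. Suppose that $\Sigma$ satisfies (almost surely, if $X$ is random) the $\kappa$-restricted eigenvalue condition: $\kappa>0$ and $\beta^\top\Sigma\beta\ge\kappa\|\beta\|^2$ for every $\beta\in\mathbb{R}^p$ such that $\|\beta_{S^c}\|_1\le3\|\beta_S\|_1$ for some $S\supseteq S^*$ with $|S|\le1.5s$. Then, with probability at least $1-Cp^2\exp(-cns^{-2}\zeta^{-1})$: whenever $$\lambda\ge6K',\qquad \rho_1>\max\Big(\frac{4a}{(a+1)\min_{i\in S^*}|\beta_i^*|},\frac{5\kappa K''}{8\lambda}\Big),\qquad \rho_3\le\sqrt{\frac{5\kappa}{18\sqrt3\,\lambda}},$$ one has $\beta^k=\beta^{\rm LS}$ and $\mathrm{sign}(\beta^k)=\mathrm{sign}(\beta^*)$ for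 all $k\ge\hat k+1$, where $\hat k$ is the smallest integer greater than $$\frac{0.5\ln s}{\ln[(9\sqrt3-4)5\kappa\lambda^{-1}]-\ln[147\sqrt3\,\rho_3^2]} .$$ -/

import Mathlib

open MeasureTheory ProbabilityTheory Matrix
open scoped NNReal

noncomputable section

namespace CaZnRLS

/-! Vectors and matrices -/

/-- The support `S*` of a vector. -/
def supp {p : ℕ} (b : Fin p → ℝ) : Finset (Fin p) :=
  Finset.univ.filter fun i => b i ≠ 0

/-- The number `s` of nonzero entries. -/
def nnz {p : ℕ} (b : Fin p → ℝ) : ℕ := (supp b).card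

/-- The smallest absolute value of the entries of `b` on its support. -/
def minAbs {p : ℕ} (b : Fin p → ℝ) : ℝ := ⨅ i : {i // i ∈ supp b}, |b i.1|

/-- The `ℓ₁` norm. -/
def l1Norm {p : ℕ} (b : Fin p → ℝ) : ℝ := ∑ i, |b i|

/-- The entries of `b`, followed by zeros. -/
def padZero {p : ℕ} (b : Fin p → ℝ) : ℕ → ℝ :=
  fun i => if h : i < p then b ⟨i, h⟩ else 0

/-- The elementwise maximum norm of a matrix (it is `0` for a matrix without entries). -/
def maxNorm {m n : Type*} (M : Matrix m n ℝ) : ℝ := ⨆ ij : m × n, |M ij.1 ij.2|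

/-- The largest eigenvalue of a (symmetric) matrix. -/
def lamMax {p : ℕ} (M : Matrix (Fin p) (Fin p) ℝ) : ℝ := sSup (spectrum ℝ M)

/-- The block `M_{S S}`. -/
def blockIn {p : ℕ} (M : Matrix (Fin p) (Fin p) ℝ) (S : Finset (Fin p)) :
    Matrix {i // i ∈ S} {i // i ∈ S} ℝ :=
  M.submatrix Subtype.val Subtype.val

/-- The block `M_{Sᶜ S}`. -/
def blockOut {p : ℕ} (M : Matrix (Fin p) (Fin p) ℝ) (S : Finset (Fin p)) :
    Matrix {i // i ∉ S} {i // i ∈ S} ℝ :=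
  M.submatrix Subtype.val Subtype.val

/-! The restricted eigenvalue condition -/

/-- The Gram matrix `n⁻¹ Xᵀ X` of a matrix with `n` rows. -/
def gram {n p : ℕ} (X : Matrix (Fin n) (Fin p) ℝ) : Matrix (Fin p) (Fin p) ℝ :=
  (1 / (n : ℝ)) • (Xᵀ * X)

/-- The union of the cones `‖b_{Sᶜ}‖₁ ≤ 3 ‖b_S‖₁` over all `S ⊇ S*` with `|S| ≤ 1.5 |S*|`. -/
def cone {p : ℕ} (Sstar : Finset (Fin p)) : Set (Fin p → ℝ) :=
  {b | ∃ S : Finset (Fin p), Sstar ⊆ S ∧ (S.card : ℝ) ≤ (3 / 2) * (Sstar.card : ℝ) ∧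
    ∑ i ∈ Sᶜ, |b i| ≤ 3 * ∑ i ∈ S, |b i|}

/-- The `κ`-restricted eigenvalue condition of `Sig` on the cone of `S*`. -/
def REC {p : ℕ} (Sig : Matrix (Fin p) (Fin p) ℝ) (Sstar : Finset (Fin p)) (κ : ℝ) : Prop :=
  0 < κ ∧ ∀ b ∈ cone Sstar, κ * ∑ i, b i ^ 2 ≤ b ⬝ᵥ (Sig *ᵥ b)

/-! The calibrated least squares loss -/

/-- For a symmetric `M = P Diag(θ) Pᵀ` the matrix `P Diag(max(θ, e)) Pᵀ`, that is, the
projection (in Frobenius norm) of `M` onto the matrices `W` with `W - e I` positive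
semidefinite. -/
def calibrated {p : ℕ} (M : Matrix (Fin p) (Fin p) ℝ) (e : ℝ) : Matrix (Fin p) (Fin p) ℝ :=
  cfc (fun t : ℝ => max t e) M

/-- `Z̃ = √n P Diag(√max(θ, e)) Pᵀ` where `M = P Diag(θ) Pᵀ`. -/
def calZ {p : ℕ} (n : ℕ) (M : Matrix (Fin p) (Fin p) ℝ) (e : ℝ) : Matrix (Fin p) (Fin p) ℝ :=
  √(n : ℝ) • cfc (fun t : ℝ => √(max t e)) M

/-- `ỹ = √n P Diag(1 / √max(θ, e)) Pᵀ ξ` where `M = P Diag(θ) Pᵀ`. -/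
def calY {p : ℕ} (n : ℕ) (M : Matrix (Fin p) (Fin p) ℝ) (e : ℝ) (ξ : Fin p → ℝ) :
    Fin p → ℝ :=
  √(n : ℝ) • (cfc (fun t : ℝ => 1 / √(max t e)) M *ᵥ ξ)

/-- The least squares loss `(2n)⁻¹ ‖Z b - y‖²`. -/
def lsLoss {p : ℕ} (n : ℕ) (Z : Matrix (Fin p) (Fin p) ℝ) (y b : Fin p → ℝ) : ℝ :=
  1 / (2 * (n : ℝ)) * ∑ j, ((Z *ᵥ b) j - y j) ^ 2

/-- `b` minimizes the least squares loss among the vectors supported in `S`. -/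
def IsOracleLS {p : ℕ} (n : ℕ) (Z : Matrix (Fin p) (Fin p) ℝ) (y : Fin p → ℝ)
    (S : Finset (Fin p)) (b : Fin p → ℝ) : Prop :=
  supp b ⊆ S ∧ ∀ b', supp b' ⊆ S → lsLoss n Z y b ≤ lsLoss n Z y b'

/-! The multi-stage convex relaxation algorithm -/

/-- `φ(t) = (a-1)/(a+1) t² + 2/(a+1) t`. -/
def phi (a t : ℝ) : ℝ := (a - 1) / (a + 1) * t ^ 2 + 2 / (a + 1) * t

/-- `β¹, β², …`, `w⁰, w¹, …` and `ρ₀, ρ₁, …` are produced by the algorithm for the data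
`(Z, y)` with the parameters `a` and `lam` (the value `β 0` is not used). -/
structure IsRun {p : ℕ} (n : ℕ) (Z : Matrix (Fin p) (Fin p) ℝ) (y : Fin p → ℝ) (a lam : ℝ)
    (w β : ℕ → Fin p → ℝ) (ρ : ℕ → ℝ) : Prop where
  one_lt_a : 1 < a
  lam_pos : 0 < lam
  rho_zero : ρ 0 = 1
  w_zero : ∀ i, 0 ≤ w 0 i ∧ w 0 i ≤ 1 / 2
  beta_min : ∀ k, ∀ b : Fin p → ℝ,
    lsLoss n Z y (β (k + 1)) + lam * ∑ i, (1 - w k i) * |β (k + 1) i| ≤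
      lsLoss n Z y b + lam * ∑ i, (1 - w k i) * |b i|
  rho_mono : ρ 0 ≤ ρ 1 ∧ ρ 1 ≤ ρ 2 ∧ ρ 2 ≤ ρ 3
  rho_const : ∀ k, 3 < k → ρ k = ρ (k - 1)
  w_mem : ∀ k, 1 ≤ k → ∀ i, 0 ≤ w k i ∧ w k i ≤ 1
  w_min : ∀ k, 1 ≤ k → ∀ i, ∀ t : ℝ, 0 ≤ t → t ≤ 1 →
    phi a (w k i) - ρ k * w k i * |β k i| ≤ phi a t - ρ k * t * |β k i|

/-! The additive error model -/

/-- `X` is the matrix of true covariates, `A` the matrix of measurement errors, `ε` the noise: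
`X`, `A`, `ε` are independent, the columns of `X` are normalized, the rows of `A` are i.i.d.
with mean zero, covariance matrix `SigA` and sub-Gaussian parameter `τ²`, and the entries of
`ε` are i.i.d. sub-Gaussian with parameter `σ²`. -/
structure AdditiveErrorModel {Ω : Type*} [MeasurableSpace Ω] (μ : Measure Ω) {n p : ℕ}
    (X A : Ω → Fin n → Fin p → ℝ) (ε : Ω → Fin n → ℝ)
    (SigA : Matrix (Fin p) (Fin p) ℝ) (τ σ : ℝ≥0) : Prop where
  measurable_X : Measurable X
  measurable_A : Measurable A
  measurable_eps : Measurable ε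
  indep_X : IndepFun X (fun ω => (A ω, ε ω)) μ
  indep_A_eps : IndepFun A ε μ
  normalized_X : ∀ᵐ ω ∂μ, ∀ j, ∑ i, X ω i j ^ 2 ≤ (n : ℝ)
  indep_A : iIndepFun (fun i ω => A ω i) μ
  identDistrib_A : ∀ i i', IdentDistrib (fun ω => A ω i) (fun ω => A ω i') μ μ
  mean_A : ∀ i j, ∫ ω, A ω i j ∂μ = 0
  cov_A : ∀ i j k, cov[fun ω => A ω i j, fun ω => A ω i k; μ] = SigA j k
  subG_A : ∀ i, ∀ v : Fin p → ℝ, ∑ j, v j ^ 2 = 1 →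
    HasSubgaussianMGF (fun ω => ∑ j, v j * A ω i j) (τ ^ 2) μ
  indep_eps : iIndepFun (fun i ω => ε ω i) μ
  identDistrib_eps : ∀ i i', IdentDistrib (fun ω => ε ω i) (fun ω => ε ω i') μ μ
  subG_eps : ∀ i, HasSubgaussianMGF (fun ω => ε ω i) (σ ^ 2) μ

/-- The surrogate `Σ̂ = n⁻¹ Zᵀ Z - Σ_A` of the Gram matrix, where `Z = X + A`. -/
def sigHat {n p : ℕ} (X A : Matrix (Fin n) (Fin p) ℝ) (SigA : Matrix (Fin p) (Fin p) ℝ) :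
    Matrix (Fin p) (Fin p) ℝ :=
  gram (X + A) - SigA

/-- The surrogate `ξ̂ = n⁻¹ Zᵀ y` of `n⁻¹ Xᵀ y`, where `Z = X + A` and `y = X β* + ε`. -/
def xiHat {n p : ℕ} (X A : Matrix (Fin n) (Fin p) ℝ) (ε : Fin n → ℝ) (b : Fin p → ℝ) :
    Fin p → ℝ :=
  (1 / (n : ℝ)) • ((X + A)ᵀ *ᵥ (X *ᵥ b + ε))

/-- `K = 2 (λ_max(Σ_A) + e) ‖β*‖₁`. -/
def constK {p : ℕ} (SigA : Matrix (Fin p) (Fin p) ℝ) (e : ℝ) (b : Fin p → ℝ) : ℝ :=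
  2 * (lamMax SigA + e) * l1Norm b

/-- `K' = K max(2, 1 + s ‖G‖_max)` with `G = Σ̃_{S*ᶜ S*} (Σ̃_{S* S*})⁻¹`; here `M` is `Σ̃`. -/
def constK' {p : ℕ} (K : ℝ) (M : Matrix (Fin p) (Fin p) ℝ) (b : Fin p → ℝ) : ℝ :=
  K * max 2 (1 + (nnz b : ℝ) * maxNorm (blockOut M (supp b) * (blockIn M (supp b))⁻¹))

/-- `K'' = K s ‖(Σ̃_{S* S*})⁻¹‖_max`; here `M` is `Σ̃`. -/
def constK'' {p : ℕ} (K : ℝ) (M : Matrix (Fin p) (Fin p) ℝ) (b : Fin p → ℝ) : ℝ :=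
  K * (nnz b : ℝ) * maxNorm (blockIn M (supp b))⁻¹

/-- The smallest integer greater than
`0.5 ln s / (ln[(9√3 - 4) 5κ/λ] - ln[147√3 ρ₃²])` (a nonnegative number when `s ≥ 1` and
`ρ₃² ≤ 5κ/(18√3 λ)`). -/
def kHat (s : ℕ) (κ lam ρ₃ : ℝ) : ℕ :=
  ⌊(1 / 2) * Real.log s /
    (Real.log ((9 * √3 - 4) * (5 * κ / lam)) - Real.log (147 * √3 * ρ₃ ^ 2))⌋₊ + 1

end CaZnRLS

end

/-!
Write `M` for the calibrated matrix, `ν = ξ̂ - M β*` and `s` for the size of `S* = supp β*`.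

*Stochastic part.* The differences `Aᵀ A / n - Σ_A`, `Xᵀ A / n` and `Zᵀ ε / n` are all bounded
entrywise by `δ = D / s` outside an event of probability `6 p² exp (-n δ² / (8192 t²))`, where
`t = 1 + τ² + σ²` and `D` is a small number depending on the signal, on `κ` and on `λ_max(Σ_A)`
(`AdditiveErrorModel.exists_deviation_event`). The entries of the first matrix are means of
centred products of sub-Gaussian variables, which are sub-exponential (`mgf_mul_sub_le`); the
other two are linear forms in independent sub-Gaussian variables once `X`, respectively `(X, A)`,
is frozen (`measure_le_of_indepFun`). On this event `‖ν‖_∞ ≤ K`, because the calibration moves no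
entry of `Σ̂` by more than `λ_max(Σ_A) + e` (`abs_xiHat_sub_calibrated_le`), and `M ≥ Σ̂` satisfies
the restricted eigenvalue condition with constant `κ / 2` (`calibrated_restricted_eigenvalue`).

*Deterministic part* (`run_eq_oracle`). The calibrated loss has Hessian `M` and linear term `ξ̂`.
At the oracle estimator its gradient vanishes on `S*` and is at most `K' ≤ λ / 6` elsewhere, and
the oracle estimator is within `K''` of `β*`. Call a weight wrong if it differs from `1` on `S*` or
exceeds `1/2` off `S*`, and let `N_k` count the wrong weights of stage `k`. The next stage is at
distance at most `2 λ √N_k / κ` from the oracle estimator (`stage_error`), whereas each weight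
that is then still wrong forces a deviation of at least `(9√3 - 4) / (9√3 ρ)` in its coordinate.
Hence `N_k` decreases geometrically, with a ratio below `1/2`, so that the enlarged support keeps
at most `3 s / 2` elements and `N_k < 1` after `kHat` stages. A stage which starts with no wrong
weight returns the oracle estimator exactly.
-/

namespace CaZnRLS

/-! ### Spectral calibration of a symmetric matrix -/

section Calibration

open scoped MatrixOrder

lemma dotProduct_mulVec_mono {p : ℕ} {A B : Matrix (Fin p) (Fin p) ℝ} (h : A ≤ B)
    (v : Fin p → ℝ) : v ⬝ᵥ (A *ᵥ v) ≤ v ⬝ᵥ (B *ᵥ v) := by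
  have := (Matrix.le_iff.1 h).dotProduct_mulVec_nonneg v
  simp only [star_trivial, sub_mulVec, dotProduct_sub] at this
  linarith

lemma dotProduct_algebraMap_mulVec {p : ℕ} (r : ℝ) (v : Fin p → ℝ) :
    v ⬝ᵥ ((algebraMap ℝ (Matrix (Fin p) (Fin p) ℝ) r) *ᵥ v) = r * ∑ i, v i ^ 2 := by
  rw [Algebra.algebraMap_eq_smul_one, smul_mulVec, one_mulVec, dotProduct_smul, smul_eq_mul,
    dotProduct]
  congr 1
  exact Finset.sum_congr rfl fun i _ => by ring

lemma le_algebraMap_lamMax {p : ℕ} {M : Matrix (Fin p) (Fin p) ℝ} (hM : IsSelfAdjoint M) :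
    M ≤ algebraMap ℝ _ (lamMax M) := by
  refine le_algebraMap_of_spectrum_le (fun x hx => ?_) hM
  exact le_csSup (ContinuousFunctionalCalculus.isCompact_spectrum M).bddAbove hx

lemma algebraMap_le_calibrated {p : ℕ} {M : Matrix (Fin p) (Fin p) ℝ} (hM : IsSelfAdjoint M)
    (e : ℝ) : algebraMap ℝ _ e ≤ calibrated M e :=
  algebraMap_le_cfc (fun t : ℝ => max t e) e M (fun _ _ => le_max_right _ _) (by fun_prop) hM

lemma le_calibrated {p : ℕ} {M : Matrix (Fin p) (Fin p) ℝ} (hM : IsSelfAdjoint M) (e : ℝ) :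
    M ≤ calibrated M e := by
  conv_lhs => rw [← cfc_id' ℝ M]
  exact cfc_mono (fun _ _ => le_max_left _ _) (by fun_prop) (by fun_prop)

/-- Eigenvalues are raised by at most `q + e` if none of them lies below `-q`. -/
lemma calibrated_sub_le {p : ℕ} {M : Matrix (Fin p) (Fin p) ℝ} (hM : IsSelfAdjoint M)
    {e q : ℝ} (he : 0 ≤ e) (hq : 0 ≤ q) (hMq : algebraMap ℝ _ (-q) ≤ M) :
    calibrated M e - M ≤ algebraMap ℝ _ (q + e) := by
  have h : calibrated M e - M = cfc (fun t : ℝ => max t e - t) M := by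
    rw [cfc_sub (fun t : ℝ => max t e) (fun t => t) M (by fun_prop) (by fun_prop), cfc_id' ℝ M,
      calibrated]
  rw [h]
  refine cfc_le_algebraMap _ _ M (fun x hx => ?_) (by fun_prop) hM
  have := (algebraMap_le_iff_le_spectrum (R := ℝ) hM).1 hMq x hx
  rcases le_total x e with h' | h'
  · rw [max_eq_right h']; linarith
  · rw [max_eq_left h']; linarith

/-- The entries of a matrix between `0` and `q I` are bounded by `q`: test with `e_i ± e_j`. -/
lemma abs_apply_le_of_nonneg_of_le {p : ℕ} {N : Matrix (Fin p) (Fin p) ℝ} {q : ℝ}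
    (h0 : 0 ≤ N) (hq : N ≤ algebraMap ℝ _ q) (i j : Fin p) : |N i j| ≤ q := by
  have hs : N j i = N i j := by
    have := (Matrix.nonneg_iff_posSemidef.1 h0).isHermitian.apply i j
    simpa using this
  have hdiag : ∀ k, N k k ≤ q := fun k => by
    have := dotProduct_mulVec_mono hq (Pi.single k 1)
    rw [dotProduct_algebraMap_mulVec] at this
    simpa [Pi.single_apply, ite_pow, Matrix.mulVec_single, dotProduct, Matrix.col] using this
  have hp := (Matrix.nonneg_iff_posSemidef.1 h0).dotProduct_mulVec_nonneg
    (Pi.single i 1 + Pi.single j 1)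
  have hm := (Matrix.nonneg_iff_posSemidef.1 h0).dotProduct_mulVec_nonneg
    (Pi.single i 1 - Pi.single j 1)
  simp [mulVec_add, mulVec_sub, add_dotProduct, sub_dotProduct, hs] at hp hm
  have h1 := hdiag i
  have h2 := hdiag j
  rw [abs_le]
  constructor <;> linarith

lemma calZ_transpose {p : ℕ} (n : ℕ) (M : Matrix (Fin p) (Fin p) ℝ) (e : ℝ) :
    (calZ n M e)ᵀ = calZ n M e := by
  have h : IsSelfAdjoint (cfc (fun t : ℝ => √(max t e)) M) := cfc_predicate _ _
  rw [calZ, transpose_smul]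
  exact congrArg _ h.star_eq

lemma calZ_mul_calZ {p : ℕ} (n : ℕ) (M : Matrix (Fin p) (Fin p) ℝ) {e : ℝ} (he : 0 < e) :
    calZ n M e * calZ n M e = (n : ℝ) • calibrated M e := by
  rw [calZ, smul_mul_smul_comm, Real.mul_self_sqrt (Nat.cast_nonneg n),
    ← cfc_mul _ _ M (by fun_prop) (by fun_prop), calibrated]
  congr 1
  refine cfc_congr fun t _ => ?_
  exact Real.mul_self_sqrt (he.le.trans (le_max_right _ _))

lemma calZ_mulVec_calY {p : ℕ} (n : ℕ) {M : Matrix (Fin p) (Fin p) ℝ} (hM : IsSelfAdjoint M)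
    {e : ℝ} (he : 0 < e) (ξ : Fin p → ℝ) : calZ n M e *ᵥ calY n M e ξ = (n : ℝ) • ξ := by
  have hpos : ∀ t : ℝ, √(max t e) ≠ 0 := fun t =>
    (Real.sqrt_pos.2 (he.trans_le (le_max_right _ _))).ne'
  have hc : Continuous fun t : ℝ => 1 / √(max t e) :=
    continuous_const.div (by fun_prop) hpos
  rw [calZ, calY, smul_mulVec, mulVec_smul, smul_smul, Real.mul_self_sqrt (Nat.cast_nonneg n),
    mulVec_mulVec, ← cfc_mul _ _ M (by fun_prop) hc.continuousOn,
    cfc_congr (g := fun _ => (1 : ℝ)), cfc_const_one ℝ M hM, one_mulVec]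
  intro t _
  exact mul_one_div_cancel (hpos t)

/-- Second-order expansion of the calibrated loss: its Hessian is the calibrated matrix and its
linear term is `ξ`. -/
lemma lsLoss_cal_add {p n : ℕ} (hn : 0 < n) {M : Matrix (Fin p) (Fin p) ℝ}
    (hM : IsSelfAdjoint M) {e : ℝ} (he : 0 < e) (ξ b h : Fin p → ℝ) :
    lsLoss n (calZ n M e) (calY n M e ξ) (b + h) = lsLoss n (calZ n M e) (calY n M e ξ) b +
      h ⬝ᵥ (calibrated M e *ᵥ b - ξ) + 1 / 2 * (h ⬝ᵥ (calibrated M e *ᵥ h)) := by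
  set Z := calZ n M e with hZ
  set y := calY n M e ξ with hy
  have hn' : (n : ℝ) ≠ 0 := by positivity
  have hsq : ∀ u : Fin p → ℝ, ∑ j, ((Z *ᵥ u) j - y j) ^ 2 = (Z *ᵥ u - y) ⬝ᵥ (Z *ᵥ u - y) :=
    fun u => by simp [dotProduct, sq]
  have hadj : ∀ u v : Fin p → ℝ, (Z *ᵥ u) ⬝ᵥ v = u ⬝ᵥ (Z *ᵥ v) := fun u v => by
    rw [dotProduct_comm, dotProduct_mulVec, dotProduct_comm, ← mulVec_transpose, hZ,
      calZ_transpose]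
  have hZZ : ∀ u, Z *ᵥ (Z *ᵥ u) = (n : ℝ) • (calibrated M e *ᵥ u) := fun u => by
    rw [mulVec_mulVec, hZ, calZ_mul_calZ n M he, smul_mulVec]
  have hZy : Z *ᵥ y = (n : ℝ) • ξ := calZ_mulVec_calY n hM he ξ
  have e1 : h ⬝ᵥ (calibrated M e *ᵥ b - ξ) = 1 / (n : ℝ) * ((Z *ᵥ h) ⬝ᵥ (Z *ᵥ b - y)) := by
    rw [hadj, mulVec_sub, hZZ, hZy, ← smul_sub, dotProduct_smul, smul_eq_mul]
    field_simp
  have e2 : h ⬝ᵥ (calibrated M e *ᵥ h) = 1 / (n : ℝ) * ((Z *ᵥ h) ⬝ᵥ (Z *ᵥ h)) := by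
    rw [hadj, hZZ, dotProduct_smul, smul_eq_mul]
    field_simp
  have e3 : Z *ᵥ (b + h) - y = (Z *ᵥ b - y) + Z *ᵥ h := by
    rw [mulVec_add]; abel
  rw [lsLoss, lsLoss, hsq, hsq, e1, e2, e3, add_dotProduct, dotProduct_add, dotProduct_add,
    dotProduct_comm (Z *ᵥ b - y) (Z *ᵥ h)]
  field_simp
  ring

end Calibration

/-! ### The oracle estimator -/

lemma mem_supp {p : ℕ} {b : Fin p → ℝ} {i : Fin p} : i ∈ supp b ↔ b i ≠ 0 := by simp [supp]

lemma minAbs_le {p : ℕ} {b : Fin p → ℝ} {i : Fin p} (hi : i ∈ supp b) : minAbs b ≤ |b i| :=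
  ciInf_le (Set.finite_range fun i : {i // i ∈ supp b} => |b i.1|).bddBelow ⟨i, hi⟩

lemma minAbs_pos {p : ℕ} {b : Fin p → ℝ} (hb : (supp b).Nonempty) : 0 < minAbs b := by
  have : Nonempty {i // i ∈ supp b} := hb.to_subtype
  obtain ⟨i, hi⟩ := exists_eq_ciInf_of_finite (f := fun i : {i // i ∈ supp b} => |b i.1|)
  rw [minAbs, ← hi]
  exact abs_pos.2 (mem_supp.1 i.2)

lemma abs_le_maxNorm {m n : Type*} [Finite m] [Finite n] (M : Matrix m n ℝ) (i : m) (j : n) :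
    |M i j| ≤ maxNorm M :=
  le_ciSup (Set.finite_range fun ij : m × n => |M ij.1 ij.2|).bddAbove (i, j)

/-- A loss with gradient `M b - ξ` and Hessian `M`. -/
def IsQuadratic {p : ℕ} (L : (Fin p → ℝ) → ℝ) (M : Matrix (Fin p) (Fin p) ℝ)
    (ξ : Fin p → ℝ) : Prop :=
  ∀ b h, L (b + h) = L b + h ⬝ᵥ (M *ᵥ b - ξ) + 1 / 2 * (h ⬝ᵥ (M *ᵥ h))

lemma eq_zero_of_forall_le_quadratic {a c : ℝ} (h : ∀ t : ℝ, 0 ≤ t * a + t ^ 2 * c) : a = 0 := by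
  have h1 := discrim_le_zero (a := c) (b := a) (c := 0) fun t => by have := h t; nlinarith
  rw [discrim] at h1
  nlinarith [sq_nonneg a]

lemma nonneg_of_forall_le_quadratic {a c : ℝ}
    (h : ∀ t : ℝ, 0 < t → t ≤ 1 → 0 ≤ t * a + t ^ 2 * c) : 0 ≤ a := by
  have hlim : Filter.Tendsto (fun t : ℝ => a + t * c) (nhdsWithin 0 (Set.Ioi 0)) (nhds a) := by
    have : Filter.Tendsto (fun t : ℝ => a + t * c) (nhds 0) (nhds (a + 0 * c)) := by
      apply Continuous.tendsto; fun_prop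
    simpa using this.mono_left nhdsWithin_le_nhds
  refine ge_of_tendsto hlim ?_
  filter_upwards [Ioc_mem_nhdsGT (zero_lt_one' ℝ)] with t ht
  have h1 := h t ht.1 ht.2
  have h2 : 0 ≤ t * (a + t * c) := by linarith [show t * (a + t * c) = t * a + t ^ 2 * c by ring]
  exact nonneg_of_mul_nonneg_right h2 ht.1

/-- The normal equations of the least squares problem restricted to `S`. -/
lemma IsQuadratic.grad_eq_zero {p : ℕ} {L : (Fin p → ℝ) → ℝ} {M : Matrix (Fin p) (Fin p) ℝ}
    {ξ : Fin p → ℝ} (hL : IsQuadratic L M ξ) {S : Finset (Fin p)} {b : Fin p → ℝ}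
    (hb : supp b ⊆ S) (hmin : ∀ b', supp b' ⊆ S → L b ≤ L b') {i : Fin p} (hi : i ∈ S) :
    (M *ᵥ b) i = ξ i := by
  have key := eq_zero_of_forall_le_quadratic
    (a := (Pi.single i 1 : Fin p → ℝ) ⬝ᵥ (M *ᵥ b - ξ))
    (c := 1 / 2 * ((Pi.single i 1 : Fin p → ℝ) ⬝ᵥ (M *ᵥ Pi.single i 1))) fun t => by
      have h1 := hmin (b + t • Pi.single i 1) fun j hj => by
        by_contra hjS
        have hji : j ≠ i := fun h => hjS (h ▸ hi)
        have hbj : b j = 0 := by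
          by_contra h
          exact hjS (hb (mem_supp.2 h))
        exact mem_supp.1 hj (by simp [hbj, hji])
      rw [hL, smul_dotProduct, mulVec_smul, smul_dotProduct, dotProduct_smul] at h1
      simp only [smul_eq_mul] at h1
      nlinarith
  simpa [sub_eq_zero] using key

section Relaxation

variable {p : ℕ}

lemma isUnit_det_blockIn {M : Matrix (Fin p) (Fin p) ℝ} {e : ℝ} (he : 0 < e)
    (hM : ∀ v : Fin p → ℝ, e * ∑ i, v i ^ 2 ≤ v ⬝ᵥ (M *ᵥ v)) (S : Finset (Fin p)) :
    IsUnit (blockIn M S).det := by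
  rw [isUnit_iff_ne_zero]
  intro hdet
  obtain ⟨v, hv0, hv⟩ := Matrix.exists_mulVec_eq_zero_iff.2 hdet
  set u : Fin p → ℝ := fun i => if h : i ∈ S then v ⟨i, h⟩ else 0 with hu
  have hsum : ∀ f : Fin p → ℝ, ∑ i, f i * u i = ∑ i : {i // i ∈ S}, f i * v i := fun f => by
    rw [← Finset.sum_subset (Finset.subset_univ S), ← Finset.sum_coe_sort]
    · exact Finset.sum_congr rfl fun i _ => by simp [hu]
    · intro i _ hi
      simp [hu, hi]
  have hMu : ∀ i : {i // i ∈ S}, (M *ᵥ u) i = 0 := fun i => by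
    have := congrFun hv i
    rw [mulVec, dotProduct, hsum]
    simpa [mulVec, dotProduct, blockIn] using this
  have h0 : u ⬝ᵥ (M *ᵥ u) = 0 := by
    rw [dotProduct_comm, dotProduct, hsum]
    exact Finset.sum_eq_zero fun i _ => by rw [hMu, zero_mul]
  have h1 : ∑ i, u i ^ 2 ≤ 0 := by
    have := hM u
    rw [h0] at this
    exact nonpos_of_mul_nonpos_right this he
  have h2 : ∀ i, u i = 0 := fun i => by
    have h := (Finset.sum_eq_zero_iff_of_nonneg fun i _ => sq_nonneg (u i)).1
      (le_antisymm h1 (Finset.sum_nonneg fun i _ => sq_nonneg (u i))) i (Finset.mem_univ i)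
    exact pow_eq_zero_iff two_ne_zero |>.1 h
  apply hv0
  ext i
  have := h2 i
  simpa [hu] using this

section Oracle

variable {M : Matrix (Fin p) (Fin p) ℝ} {ξ βs b : Fin p → ℝ} {K : ℝ}

lemma sum_mul_eq_block {S : Finset (Fin p)} {d : Fin p → ℝ} (hd : ∀ i ∉ S, d i = 0)
    (f : Fin p → ℝ) : ∑ i, f i * d i = ∑ i : {i // i ∈ S}, f i * d i := by
  rw [← Finset.sum_subset (Finset.subset_univ S), ← Finset.sum_coe_sort]
  intro i _ hi
  simp [hd i hi]

/-- The oracle error solves the block system with right-hand side `ν = ξ - M β*`. -/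
lemma oracle_sub_eq (hdet : IsUnit (blockIn M (supp βs)).det) (hb : supp b ⊆ supp βs)
    (hgrad : ∀ i ∈ supp βs, (M *ᵥ b) i = ξ i) :
    (fun i : {i // i ∈ supp βs} => b i - βs i) =
      (blockIn M (supp βs))⁻¹ *ᵥ fun i => (ξ - M *ᵥ βs) i := by
  have hd : ∀ i ∉ supp βs, (b - βs) i = 0 := fun i hi => by
    have h1 : βs i = 0 := by simpa [mem_supp] using hi
    have h2 : b i = 0 := by
      by_contra h
      exact hi (hb (mem_supp.2 h))
    simp [h1, h2]
  have : (fun i : {i // i ∈ supp βs} => (ξ - M *ᵥ βs) i) =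
      blockIn M (supp βs) *ᵥ fun i => b i - βs i := by
    ext i
    rw [Pi.sub_apply, ← hgrad i i.2, ← Pi.sub_apply, ← mulVec_sub, mulVec, dotProduct,
      sum_mul_eq_block hd]
    rfl
  rw [this, mulVec_mulVec, nonsing_inv_mul _ hdet, one_mulVec]

lemma abs_mulVec_le {m n : Type*} [Finite m] [Fintype n] (N : Matrix m n ℝ) {v : n → ℝ}
    (hv : ∀ i, |v i| ≤ K) (i : m) : |(N *ᵥ v) i| ≤ K * (Fintype.card n) * maxNorm N := by
  calc |(N *ᵥ v) i| ≤ ∑ j, |N i j * v j| := Finset.abs_sum_le_sum_abs _ _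
    _ ≤ ∑ _j : n, maxNorm N * K := by
        refine Finset.sum_le_sum fun j _ => ?_
        rw [abs_mul]
        exact mul_le_mul (abs_le_maxNorm N i j) (hv j) (abs_nonneg _)
          ((abs_nonneg _).trans (abs_le_maxNorm N i j))
    _ = _ := by rw [Finset.sum_const, nsmul_eq_mul, Finset.card_univ]; ring

lemma abs_oracle_sub_le (hdet : IsUnit (blockIn M (supp βs)).det) (hb : supp b ⊆ supp βs)
    (hgrad : ∀ i ∈ supp βs, (M *ᵥ b) i = ξ i) (hν : ∀ i, |(ξ - M *ᵥ βs) i| ≤ K)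
    {i : Fin p} (hi : i ∈ supp βs) : |b i - βs i| ≤ constK'' K M βs := by
  have h := abs_mulVec_le (blockIn M (supp βs))⁻¹
    (v := fun i : {i // i ∈ supp βs} => (ξ - M *ᵥ βs) i) (fun i => hν i) ⟨i, hi⟩
  rw [← oracle_sub_eq hdet hb hgrad] at h
  simpa [constK'', nnz] using h

/-- Off the support the gradient at the oracle estimator is `ν - G ν_{S*}`. -/
lemma abs_grad_oracle_le (hdet : IsUnit (blockIn M (supp βs)).det) (hb : supp b ⊆ supp βs)
    (hgrad : ∀ i ∈ supp βs, (M *ᵥ b) i = ξ i) (hν : ∀ i, |(ξ - M *ᵥ βs) i| ≤ K)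
    {i : Fin p} (hi : i ∉ supp βs) : |ξ i - (M *ᵥ b) i| ≤ constK' K M βs := by
  have hd : ∀ i ∉ supp βs, (b - βs) i = 0 := fun i hi => by
    have h1 : βs i = 0 := by simpa [mem_supp] using hi
    have h2 : b i = 0 := by
      by_contra h
      exact hi (hb (mem_supp.2 h))
    simp [h1, h2]
  have h := abs_mulVec_le (blockOut M (supp βs) * (blockIn M (supp βs))⁻¹)
    (v := fun i : {i // i ∈ supp βs} => (ξ - M *ᵥ βs) i) (fun i => hν i) ⟨i, hi⟩
  rw [← mulVec_mulVec, ← oracle_sub_eq hdet hb hgrad] at h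
  have hout : (blockOut M (supp βs) *ᵥ fun j : {i // i ∈ supp βs} => b j - βs j) ⟨i, hi⟩ =
      (M *ᵥ (b - βs)) i := by
    rw [mulVec, mulVec, dotProduct, dotProduct, sum_mul_eq_block hd]
    rfl
  rw [hout, Fintype.card_coe] at h
  have hsplit : ξ i - (M *ᵥ b) i = (ξ - M *ᵥ βs) i - (M *ᵥ (b - βs)) i := by
    simp [mulVec_sub]
  have hK : 0 ≤ K := (abs_nonneg _).trans (hν i)
  calc |ξ i - (M *ᵥ b) i| ≤ |(ξ - M *ᵥ βs) i| + |(M *ᵥ (b - βs)) i| := by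
        rw [hsplit]; exact abs_sub _ _
    _ ≤ K * (1 + nnz βs * maxNorm (blockOut M (supp βs) * (blockIn M (supp βs))⁻¹)) := by
        rw [nnz]
        linarith [hν i]
    _ ≤ _ := mul_le_mul_of_nonneg_left (le_max_right _ _) hK

end Oracle

/-! ### One stage of the relaxation -/

/-- First-order optimality of a weighted `ℓ₁` minimizer `b'`, tested in the direction of `b`. -/
lemma IsQuadratic.basic_inequality {L : (Fin p → ℝ) → ℝ} {M : Matrix (Fin p) (Fin p) ℝ}
    {ξ : Fin p → ℝ} (hL : IsQuadratic L M ξ) {lam : ℝ} (hlam : 0 ≤ lam) {v : Fin p → ℝ}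
    (hv : ∀ i, 0 ≤ v i) {b b' : Fin p → ℝ}
    (hmin : ∀ c : Fin p → ℝ, L b' + lam * ∑ i, v i * |b' i| ≤ L c + lam * ∑ i, v i * |c i|) :
    (b' - b) ⬝ᵥ (M *ᵥ (b' - b)) ≤ (b' - b) ⬝ᵥ (ξ - M *ᵥ b) +
      lam * ∑ i, v i * (|b i| - |b' i|) := by
  set d := b' - b with hd
  have hpen : ∀ t : ℝ, 0 < t → t ≤ 1 → ∑ i, v i * |(b' + (-t) • d) i| ≤
      ∑ i, v i * |b' i| + t * ∑ i, v i * (|b i| - |b' i|) := by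
    intro t ht ht1
    rw [Finset.mul_sum, ← Finset.sum_add_distrib]
    refine Finset.sum_le_sum fun i _ => ?_
    have h1 : (b' + (-t) • d) i = (1 - t) * b' i + t * b i := by simp [hd]; ring
    have h2 : |(1 - t) * b' i + t * b i| ≤ (1 - t) * |b' i| + t * |b i| := by
      refine (abs_add_le _ _).trans_eq ?_
      rw [abs_mul, abs_mul, abs_of_nonneg (by linarith : 0 ≤ 1 - t), abs_of_pos ht]
    rw [h1]
    have := mul_le_mul_of_nonneg_left h2 (hv i)
    linarith
  have key := nonneg_of_forall_le_quadratic
    (a := - (d ⬝ᵥ (M *ᵥ b' - ξ)) + lam * ∑ i, v i * (|b i| - |b' i|))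
    (c := 1 / 2 * (d ⬝ᵥ (M *ᵥ d))) fun t ht ht1 => by
      have h1 := hmin (b' + (-t) • d)
      rw [hL, smul_dotProduct, mulVec_smul, smul_dotProduct, dotProduct_smul] at h1
      simp only [smul_eq_mul] at h1
      have h2 := mul_le_mul_of_nonneg_left (hpen t ht ht1) hlam
      nlinarith
  have h3 : M *ᵥ b' - ξ = M *ᵥ d - (ξ - M *ᵥ b) := by rw [hd, mulVec_sub]; abel
  rw [h3, dotProduct_sub] at key
  linarith

/-- The indices whose weights are wrong: those in `S` not fully released from the penalty and
those outside `S` of weight above `1/2`. -/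
noncomputable def wrongSet (S : Finset (Fin p)) (w : Fin p → ℝ) : Finset (Fin p) :=
  Finset.univ.filter fun i => (i ∈ S ∧ w i ≠ 1) ∨ (i ∉ S ∧ 1 / 2 < w i)

lemma mem_wrongSet {S : Finset (Fin p)} {w : Fin p → ℝ} {i : Fin p} :
    i ∈ wrongSet S w ↔ (i ∈ S ∧ w i ≠ 1) ∨ (i ∉ S ∧ 1 / 2 < w i) := by simp [wrongSet]

/-- The error of a stage is controlled by the number of wrong weights it starts from. The error
lies in the cone of `S` enlarged by the wrong indices, so that restricted strong convexity
applies; only wrong indices contribute positively to the basic inequality. -/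
lemma stage_error {L : (Fin p → ℝ) → ℝ} {M : Matrix (Fin p) (Fin p) ℝ} {ξ : Fin p → ℝ}
    (hL : IsQuadratic L M ξ) {lam : ℝ} (hlam : 0 < lam) {w : Fin p → ℝ}
    (hM : ∀ u : Fin p → ℝ, 0 ≤ u ⬝ᵥ (M *ᵥ u))
    (hw0 : ∀ i, 0 ≤ w i) (hw1 : ∀ i, w i ≤ 1) {S : Finset (Fin p)} {b b' : Fin p → ℝ}
    (hb : supp b ⊆ S) (hgrad : ∀ i ∈ S, (M *ᵥ b) i = ξ i)
    (hgrad' : ∀ i ∉ S, |ξ i - (M *ᵥ b) i| ≤ lam / 6)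
    (hmin : ∀ c : Fin p → ℝ,
      L b' + lam * ∑ i, (1 - w i) * |b' i| ≤ L c + lam * ∑ i, (1 - w i) * |c i|)
    {κ : ℝ} (hκ : 0 < κ) (hREC : ∀ u ∈ cone S, κ * ∑ i, u i ^ 2 ≤ u ⬝ᵥ (M *ᵥ u))
    (hcard : ((wrongSet S w \ S).card : ℝ) ≤ 1 / 2 * S.card) :
    κ ^ 2 * ∑ i, (b' - b) i ^ 2 ≤ lam ^ 2 * (wrongSet S w).card := by
  set d := b' - b with hd
  set F := wrongSet S w with hF
  have hbasic := hL.basic_inequality hlam.le (fun i => by linarith [hw1 i]) hmin (b := b)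
  rw [← hd] at hbasic
  have hterm : ∀ i, d i * (ξ - M *ᵥ b) i + lam * ((1 - w i) * (|b i| - |b' i|)) ≤
      lam * (if i ∈ F then |d i| else 0) - lam / 3 * (if i ∈ S ∪ F then 0 else |d i|) := by
    intro i
    have habs : |b i| - |b' i| ≤ |d i| := by
      rw [hd, Pi.sub_apply, abs_sub_comm]; exact abs_sub_abs_le_abs_sub _ _
    have hdi := abs_nonneg (d i)
    by_cases hi : i ∈ S
    · rw [Pi.sub_apply, hgrad i hi, sub_self, mul_zero, zero_add,
        if_pos (Finset.mem_union_left _ hi), mul_zero, sub_zero]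
      refine mul_le_mul_of_nonneg_left ?_ hlam.le
      by_cases hwi : w i = 1
      · rw [hwi, sub_self, zero_mul]
        split_ifs <;> simp
      · rw [if_pos (mem_wrongSet.2 (Or.inl ⟨hi, hwi⟩))]
        nlinarith [hw0 i, hw1 i]
    · have hbi : b i = 0 := by
        by_contra h
        exact hi (hb (mem_supp.2 h))
      have hdb : |b' i| = |d i| := by rw [hd, Pi.sub_apply, hbi, sub_zero]
      have hg : d i * (ξ - M *ᵥ b) i ≤ lam / 6 * |d i| := by
        refine (le_abs_self _).trans ?_
        rw [abs_mul, mul_comm]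
        exact mul_le_mul_of_nonneg_right (hgrad' i hi) hdi
      rw [hbi, abs_zero, hdb, zero_sub]
      have hld : 0 ≤ lam * |d i| := by positivity
      by_cases hwi : 1 / 2 < w i
      · have hiF : i ∈ F := mem_wrongSet.2 (Or.inr ⟨hi, hwi⟩)
        rw [if_pos hiF, if_pos (Finset.mem_union_right _ hiF)]
        nlinarith [hw1 i]
      · have hiF : i ∉ F := fun h => by
          rcases mem_wrongSet.1 h with h | h
          · exact hi h.1
          · exact hwi h.2
        rw [if_neg hiF, if_neg (by simp [hi, hiF])]
        nlinarith
  have hsum : d ⬝ᵥ (M *ᵥ d) ≤ lam * ∑ i ∈ F, |d i| - lam / 3 * ∑ i ∈ (S ∪ F)ᶜ, |d i| := by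
    refine hbasic.trans ?_
    rw [dotProduct, Finset.mul_sum, ← Finset.sum_add_distrib]
    refine (Finset.sum_le_sum fun i _ => hterm i).trans_eq ?_
    rw [Finset.sum_sub_distrib, ← Finset.mul_sum, ← Finset.mul_sum, Finset.sum_ite_mem,
      Finset.univ_inter]
    congr 2
    rw [Finset.sum_ite, Finset.sum_const_zero, zero_add]
    exact Finset.sum_congr (by ext; simp) fun _ _ => rfl
  have hpos : 0 ≤ ∑ i ∈ (S ∪ F)ᶜ, |d i| := Finset.sum_nonneg fun _ _ => abs_nonneg _
  have hFpos : 0 ≤ ∑ i ∈ F, |d i| := Finset.sum_nonneg fun _ _ => abs_nonneg _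
  have hcone : d ∈ cone S := by
    refine ⟨S ∪ F, Finset.subset_union_left, ?_, ?_⟩
    · rw [← Finset.union_sdiff_self_eq_union, Finset.card_union_of_disjoint Finset.disjoint_sdiff,
        Nat.cast_add]
      linarith
    · have h1 : ∑ i ∈ F, |d i| ≤ ∑ i ∈ S ∪ F, |d i| :=
        Finset.sum_le_sum_of_subset_of_nonneg Finset.subset_union_right fun _ _ _ => abs_nonneg _
      have h2 := (hM d).trans hsum
      have h3 : lam / 3 * ∑ i ∈ (S ∪ F)ᶜ, |d i| ≤ lam / 3 * (3 * ∑ i ∈ F, |d i|) := by linarith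
      linarith [le_of_mul_le_mul_left h3 (by positivity)]
  have hκd : κ * ∑ i, d i ^ 2 ≤ lam * ∑ i ∈ F, |d i| := by
    have := hREC d hcone
    have : 0 ≤ lam / 3 * ∑ i ∈ (S ∪ F)ᶜ, |d i| := by positivity
    linarith
  have hCS : (∑ i ∈ F, |d i|) ^ 2 ≤ F.card * ∑ i, d i ^ 2 := by
    refine (sq_sum_le_card_mul_sum_sq (s := F) (f := fun i => |d i|)).trans ?_
    refine mul_le_mul_of_nonneg_left ?_ (Nat.cast_nonneg _)
    simp only [sq_abs]
    exact Finset.sum_le_sum_of_subset_of_nonneg (Finset.subset_univ _) fun _ _ _ => sq_nonneg _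
  set D := ∑ i, d i ^ 2 with hD
  have hD0 : 0 ≤ D := Finset.sum_nonneg fun _ _ => sq_nonneg _
  rcases hD0.eq_or_lt with h0 | h0
  · rw [← h0, mul_zero]; positivity
  · have h1 : (κ * D) ^ 2 ≤ lam ^ 2 * (F.card * D) :=
      calc (κ * D) ^ 2 ≤ (lam * ∑ i ∈ F, |d i|) ^ 2 := by gcongr
        _ = lam ^ 2 * (∑ i ∈ F, |d i|) ^ 2 := by ring
        _ ≤ _ := by gcongr
    refine le_of_mul_le_mul_right ?_ h0
    linarith

lemma lt_of_weight_ne_one {a ρ x w : ℝ} (ha : 1 < a) (hw : w ≤ 1) (hne : w ≠ 1)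
    (hmin : phi a w - ρ * w * x ≤ phi a 1 - ρ * 1 * x) : ρ * x < 2 * a / (a + 1) := by
  have hw1 : w < 1 := lt_of_le_of_ne hw hne
  have h : (1 - w) * (ρ * x) ≤ (1 - w) * ((a - 1) / (a + 1) * (1 + w) + 2 / (a + 1)) := by
    simp only [phi] at hmin
    linarith
  refine (le_of_mul_le_mul_left h (by linarith)).trans_lt ?_
  have ha' : 0 < (a - 1) / (a + 1) := div_pos (by linarith) (by linarith)
  have hsum : 2 * a / (a + 1) = (a - 1) / (a + 1) * 2 + 2 / (a + 1) := by field_simp; ring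
  rw [hsum]
  nlinarith

lemma one_le_of_half_lt_weight {a ρ x w : ℝ} (ha : 1 < a) (hw : 1 / 2 < w)
    (hmin : phi a w - ρ * w * x ≤ phi a (1 / 2) - ρ * (1 / 2) * x) : 1 ≤ ρ * x := by
  have h : (w - 1 / 2) * ((a - 1) / (a + 1) * (w + 1 / 2) + 2 / (a + 1)) ≤
      (w - 1 / 2) * (ρ * x) := by
    simp only [phi] at hmin
    linarith
  refine le_trans ?_ (le_of_mul_le_mul_left h (by linarith))
  have ha' : 0 < (a - 1) / (a + 1) := div_pos (by linarith) (by linarith)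
  have hsum : (1 : ℝ) = (a - 1) / (a + 1) + 2 / (a + 1) := by field_simp; ring
  nlinarith

/-! ### Convergence of the relaxation in finitely many stages -/

lemma kHat_spec {s k : ℕ} {κ lam ρ₃ : ℝ} (hs : 0 < s)
    (hA : 0 < (9 * √3 - 4) * (5 * κ / lam)) (hB : 0 < 147 * √3 * ρ₃ ^ 2)
    (hAB : 147 * √3 * ρ₃ ^ 2 < (9 * √3 - 4) * (5 * κ / lam)) (hk : kHat s κ lam ρ₃ ≤ k) :
    ((147 * √3 * ρ₃ ^ 2 / ((9 * √3 - 4) * (5 * κ / lam))) ^ 2) ^ k * s < 1 := by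
  have h1 := Nat.lt_floor_add_one ((1 / 2) * Real.log s /
    (Real.log ((9 * √3 - 4) * (5 * κ / lam)) - Real.log (147 * √3 * ρ₃ ^ 2)))
  have h2 : ((kHat s κ lam ρ₃ : ℕ) : ℝ) ≤ k := by exact_mod_cast hk
  rw [kHat] at h2
  push_cast at h2
  have h3 := h1.trans_le h2
  have hlog := Real.log_lt_log hB hAB
  rw [div_lt_iff₀ (by linarith)] at h3
  have hs' : (0 : ℝ) < s := by exact_mod_cast hs
  set A := (9 * √3 - 4) * (5 * κ / lam)
  set B := 147 * √3 * ρ₃ ^ 2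
  rw [← Real.log_neg_iff (by positivity), Real.log_mul (by positivity) hs'.ne', Real.log_pow,
    Real.log_pow, Real.log_div hB.ne' hA.ne']
  push_cast
  linarith

set_option maxHeartbeats 800000 in
/-- On the deterministic level the relaxation reaches the oracle estimator: the number of wrong
weights shrinks geometrically, hence vanishes after `kHat` stages. -/
theorem run_eq_oracle {n : ℕ} {Z : Matrix (Fin p) (Fin p) ℝ} {y : Fin p → ℝ}
    {M : Matrix (Fin p) (Fin p) ℝ} {ξ βs : Fin p → ℝ} (hL : IsQuadratic (lsLoss n Z y) M ξ)
    {e : ℝ} (he : 0 < e) (hM : ∀ v : Fin p → ℝ, e * ∑ i, v i ^ 2 ≤ v ⬝ᵥ (M *ᵥ v))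
    (hβs : βs ≠ 0) {κ : ℝ} (hκ : 0 < κ)
    (hREC : ∀ u ∈ cone (supp βs), κ / 2 * ∑ i, u i ^ 2 ≤ u ⬝ᵥ (M *ᵥ u)) {K : ℝ}
    (hν : ∀ i, |(ξ - M *ᵥ βs) i| ≤ K) {a lam : ℝ} {w β : ℕ → Fin p → ℝ} {ρ : ℕ → ℝ}
    {b : Fin p → ℝ} (hrun : IsRun n Z y a lam w β ρ) (hb : IsOracleLS n Z y (supp βs) b)
    (hlam : 6 * constK' K M βs ≤ lam)
    (hρ1 : max (4 * a / ((a + 1) * minAbs βs)) (5 * κ * constK'' K M βs / (8 * lam)) < ρ 1)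
    (hρ3 : ρ 3 ≤ √(5 * κ / (18 * √3 * lam))) {k : ℕ} (hk : kHat (nnz βs) κ lam (ρ 3) + 1 ≤ k) :
    β k = b ∧ ∀ i, SignType.sign (β k i) = SignType.sign (βs i) := by
  have hlam0 := hrun.lam_pos
  have ha := hrun.one_lt_a
  have hne : (supp βs).Nonempty := by
    obtain ⟨i, hi⟩ := Function.ne_iff.1 hβs
    exact ⟨i, mem_supp.2 hi⟩
  have hs : 0 < nnz βs := Finset.card_pos.2 hne
  have hs' : (0 : ℝ) < nnz βs := by exact_mod_cast hs
  have hmin0 := minAbs_pos hne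
  have hdet := isUnit_det_blockIn he hM (supp βs)
  have hgrad : ∀ i ∈ supp βs, (M *ᵥ b) i = ξ i := fun i hi => hL.grad_eq_zero hb.1 hb.2 hi
  have hgrad' : ∀ i ∉ supp βs, |ξ i - (M *ᵥ b) i| ≤ lam / 6 := fun i hi =>
    (abs_grad_oracle_le hdet hb.1 hgrad hν hi).trans (by linarith)
  have hK'' : ∀ i ∈ supp βs, |b i - βs i| ≤ constK'' K M βs := fun i hi =>
    abs_oracle_sub_le hdet hb.1 hgrad hν hi
  have hK0 : 0 ≤ constK'' K M βs := (abs_nonneg _).trans (hK'' _ hne.choose_spec)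
  have hbout : ∀ i ∉ supp βs, b i = 0 := fun i hi => by
    by_contra h
    exact hi (hb.1 (mem_supp.2 h))
  -- the penalty parameters increase up to the third stage and stay constant afterwards
  obtain ⟨h01, h12, h23⟩ := hrun.rho_mono
  rw [hrun.rho_zero] at h01
  have hρconst : ∀ j, ρ (3 + j) = ρ 3 := fun j => by
    induction j with
    | zero => rfl
    | succ j ih => rw [← ih, hrun.rho_const (3 + (j + 1)) (by omega)]; rfl
  have hρ_le : ∀ j, 1 ≤ j → ρ 1 ≤ ρ j ∧ ρ j ≤ ρ 3 := fun j hj => by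
    rcases le_or_gt 3 j with h | h
    · obtain ⟨i, rfl⟩ := Nat.exists_eq_add_of_le h
      rw [hρconst]
      exact ⟨h12.trans h23, le_rfl⟩
    · interval_cases j
      · exact ⟨le_rfl, h12.trans h23⟩
      · exact ⟨h12, h23⟩
  set r := √(3 : ℝ) with hr
  have hr1 : 1.732 < r := Real.lt_sqrt_of_sq_lt (by norm_num)
  have hρ3pos : 1 ≤ ρ 3 := by linarith
  have hρ3sq : 18 * r * lam * ρ 3 ^ 2 ≤ 5 * κ := by
    have h := (Real.le_sqrt' (by linarith)).1 hρ3
    rw [le_div_iff₀ (by positivity)] at h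
    linarith
  have hρK : 9 * r * (ρ 3 * constK'' K M βs) ≤ 4 := by
    have h1 := (le_max_right _ _).trans_lt hρ1
    rw [div_lt_iff₀ (by positivity)] at h1
    have h2 : lam * ρ 3 * (9 * r * (ρ 3 * constK'' K M βs)) ≤ lam * ρ 3 * 4 := by
      have h3 := mul_le_mul_of_nonneg_right hρ3sq hK0
      have h4 : lam * ρ 1 ≤ lam * ρ 3 := by gcongr; linarith
      linarith
    exact le_of_mul_le_mul_left h2 (by positivity)
  have hminρ : 4 * a / (a + 1) < ρ 1 * minAbs βs := by
    have h1 := (le_max_left _ _).trans_lt hρ1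
    rw [← div_div, div_lt_iff₀ hmin0] at h1
    exact h1
  have h2a : 1 < 2 * a / (a + 1) := by rw [lt_div_iff₀ (by linarith)]; linarith
  have h4a : 4 * a / (a + 1) = 2 * (2 * a / (a + 1)) := by ring
  -- a wrong weight witnesses a coordinate at which the stage is far from the oracle
  have hfar : ∀ j, 1 ≤ j → ∀ i ∈ wrongSet (supp βs) (w j),
      9 * r - 4 ≤ 9 * r * (ρ j * |(β j - b) i|) := by
    intro j hj i hi
    obtain ⟨hρl, hρu⟩ := hρ_le j hj
    have hρ0 : 0 < ρ j := by linarith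
    rcases mem_wrongSet.1 hi with ⟨hiS, hwi⟩ | ⟨hiS, hwi⟩
    · have h1 := lt_of_weight_ne_one ha (hrun.w_mem j hj i).2 hwi
        (hrun.w_min j hj i 1 zero_le_one le_rfl)
      have h2 : 4 * a / (a + 1) < ρ j * |βs i| :=
        hminρ.trans_le (mul_le_mul hρl (minAbs_le hiS) hmin0.le hρ0.le)
      have h3 : |βs i| ≤ |β j i| + |(β j - b) i| + |b i - βs i| := by
        have h4 := abs_add_le (β j i - (β j - b) i) (-(b i - βs i))
        rw [abs_neg] at h4
        have h5 := abs_sub (β j i) ((β j - b) i)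
        have h6 : βs i = (β j i - (β j - b) i) + -(b i - βs i) := by simp
        rw [← h6] at h4
        linarith
      have h4 : ρ j * |b i - βs i| ≤ ρ 3 * constK'' K M βs :=
        mul_le_mul hρu (hK'' i hiS) (abs_nonneg _) (by linarith)
      have h5 := mul_le_mul_of_nonneg_left h3 hρ0.le
      have h6 : 1 - ρ 3 * constK'' K M βs ≤ ρ j * |(β j - b) i| := by linarith
      have h7 := mul_le_mul_of_nonneg_left h6 (by positivity : 0 ≤ 9 * r)
      linarith
    · have h1 := one_le_of_half_lt_weight ha hwi
        (hrun.w_min j hj i (1 / 2) (by norm_num) (by norm_num))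
      rw [Pi.sub_apply, hbout i hiS, sub_zero]
      have h7 := mul_le_mul_of_nonneg_left h1 (by positivity : 0 ≤ 9 * r)
      linarith
  set A := (9 * r - 4) * (5 * κ / lam) with hA
  set B := 147 * r * ρ 3 ^ 2 with hB
  have hm : 0 < 9 * r - 4 := by linarith
  have hA0 : 0 < A := by positivity
  have hB0 : 0 < B := by positivity
  have hκlam : 18 * r * ρ 3 ^ 2 ≤ 5 * κ / lam := by
    rw [le_div_iff₀ hlam0]; linarith
  have hBA : B ≤ 7048 / 10000 * A := by
    have h1 : 11.588 * (18 * r * ρ 3 ^ 2) ≤ A :=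
      mul_le_mul (by linarith) hκlam (by positivity) hm.le
    have h2 : 0 ≤ r * ρ 3 ^ 2 := by positivity
    rw [hB]
    linarith
  have hq : (B / A) ^ 2 ≤ 1 / 2 := by
    have : B / A ≤ 7048 / 10000 := by rwa [div_le_iff₀ hA0]
    have h0 : 0 ≤ B / A := by positivity
    nlinarith
  have hw01 : ∀ j i, 0 ≤ w j i ∧ w j i ≤ 1 := fun j i => by
    rcases Nat.eq_zero_or_pos j with rfl | hj
    · exact ⟨(hrun.w_zero i).1, (hrun.w_zero i).2.trans (by norm_num)⟩
    · exact hrun.w_mem j hj i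
  have hstage : ∀ j, ((wrongSet (supp βs) (w j) \ supp βs).card : ℝ) ≤ 1 / 2 * (supp βs).card →
      (κ / 2) ^ 2 * ∑ i, (β (j + 1) - b) i ^ 2 ≤
        lam ^ 2 * (wrongSet (supp βs) (w j)).card := fun j hj =>
    stage_error hL hlam0
      (fun u => (mul_nonneg he.le (Finset.sum_nonneg fun _ _ => sq_nonneg _)).trans (hM u))
      (fun i => (hw01 j i).1) (fun i => (hw01 j i).2) hb.1 hgrad hgrad'
      (hrun.beta_min j) (by positivity) hREC hj
  have hmain : ∀ j, ((wrongSet (supp βs) (w j) \ supp βs).card : ℝ) ≤ 1 / 2 * (supp βs).card ∧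
      ((wrongSet (supp βs) (w j)).card : ℝ) ≤ ((B / A) ^ 2) ^ j * nnz βs := by
    intro j
    induction j with
    | zero =>
      have hsub : wrongSet (supp βs) (w 0) ⊆ supp βs := fun i hi => by
        rcases mem_wrongSet.1 hi with h | h
        · exact h.1
        · linarith [h.2, (hrun.w_zero i).2]
      refine ⟨?_, ?_⟩
      · rw [Finset.sdiff_eq_empty_iff_subset.2 hsub, Finset.card_empty, Nat.cast_zero]
        positivity
      · rw [pow_zero, one_mul]
        exact_mod_cast Finset.card_le_card hsub
    | succ j ih =>
      set F := wrongSet (supp βs) (w (j + 1)) with hF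
      have h1 := hstage j ih.1
      set D := ∑ i, (β (j + 1) - b) i ^ 2 with hD
      have h2 : (F.card : ℝ) * (9 * r - 4) ^ 2 ≤ (9 * r * ρ 3 ^ 2) ^ 2 * D := by
        calc (F.card : ℝ) * (9 * r - 4) ^ 2 = ∑ _i ∈ F, (9 * r - 4) ^ 2 := by
              rw [Finset.sum_const, nsmul_eq_mul]
          _ ≤ ∑ i ∈ F, (9 * r * ρ 3 ^ 2) ^ 2 * (β (j + 1) - b) i ^ 2 := by
              refine Finset.sum_le_sum fun i hi => ?_
              have h3 := hfar (j + 1) (by omega) i hi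
              have h4 : ρ (j + 1) ≤ ρ 3 ^ 2 :=
                (hρ_le (j + 1) (by omega)).2.trans (by nlinarith)
              have h5 : 9 * r - 4 ≤ 9 * r * ρ 3 ^ 2 * |(β (j + 1) - b) i| := by
                refine h3.trans ?_
                rw [mul_assoc (9 * r)]
                exact mul_le_mul_of_nonneg_left
                  (mul_le_mul_of_nonneg_right h4 (abs_nonneg _)) (by positivity)
              rw [← sq_abs ((β (j + 1) - b) i), ← mul_pow]
              gcongr
          _ ≤ ∑ i, (9 * r * ρ 3 ^ 2) ^ 2 * (β (j + 1) - b) i ^ 2 :=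
              Finset.sum_le_sum_of_subset_of_nonneg (Finset.subset_univ _)
                fun _ _ _ => by positivity
          _ = _ := by rw [← Finset.mul_sum]
      have h3 : (F.card : ℝ) * A ^ 2 ≤
          B ^ 2 * (wrongSet (supp βs) (w j)).card := by
        have hκl : 0 < κ / lam := by positivity
        have h1' : (κ / lam) ^ 2 * D ≤ 4 * (wrongSet (supp βs) (w j)).card := by
          rw [div_pow, div_mul_eq_mul_div, div_le_iff₀ (by positivity)]
          linarith
        have h4 : (F.card : ℝ) * A ^ 2 = 25 * (κ / lam) ^ 2 * (F.card * (9 * r - 4) ^ 2) := by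
          rw [hA]; ring
        rw [h4]
        calc 25 * (κ / lam) ^ 2 * (F.card * (9 * r - 4) ^ 2)
            ≤ 25 * (κ / lam) ^ 2 * ((9 * r * ρ 3 ^ 2) ^ 2 * D) := by gcongr
          _ = 25 * (9 * r * ρ 3 ^ 2) ^ 2 * ((κ / lam) ^ 2 * D) := by ring
          _ ≤ 25 * (9 * r * ρ 3 ^ 2) ^ 2 * (4 * (wrongSet (supp βs) (w j)).card) := by gcongr
          _ = (90 * (r * ρ 3 ^ 2)) ^ 2 * (wrongSet (supp βs) (w j)).card := by ring
          _ ≤ (147 * (r * ρ 3 ^ 2)) ^ 2 * (wrongSet (supp βs) (w j)).card := by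
              gcongr; norm_num
          _ = _ := by rw [hB]; ring
      have h4 : (F.card : ℝ) ≤ (B / A) ^ 2 * (wrongSet (supp βs) (w j)).card := by
        rw [div_pow, div_mul_eq_mul_div, le_div_iff₀ (by positivity)]
        exact h3
      have h5 : (F.card : ℝ) ≤ ((B / A) ^ 2) ^ (j + 1) * nnz βs := by
        refine h4.trans ?_
        rw [pow_succ' ((B / A) ^ 2) j, mul_assoc]
        exact mul_le_mul_of_nonneg_left ih.2 (by positivity)
      refine ⟨?_, h5⟩
      have h6 : ((F \ supp βs).card : ℝ) ≤ F.card := by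
        exact_mod_cast Finset.card_le_card Finset.sdiff_subset
      have h7 : ((B / A) ^ 2) ^ (j + 1) ≤ 1 / 2 := by
        refine (pow_le_of_le_one (sq_nonneg _) ?_ j.succ_ne_zero).trans hq
        exact hq.trans (by norm_num)
      refine h6.trans (h5.trans ?_)
      exact mul_le_mul_of_nonneg_right h7 (Nat.cast_nonneg _)
  obtain ⟨j, rfl⟩ : ∃ j, k = j + 1 := ⟨k - 1, by omega⟩
  have hlt := (hmain j).2.trans_lt
    (kHat_spec hs hA0 hB0 (by linarith) (by omega : kHat (nnz βs) κ lam (ρ 3) ≤ j))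
  have hempty : (wrongSet (supp βs) (w j)).card = 0 := by
    have : (wrongSet (supp βs) (w j)).card < 1 := by exact_mod_cast hlt
    omega
  have hD := hstage j (hmain j).1
  rw [hempty, Nat.cast_zero, mul_zero] at hD
  have hD0 : ∑ i, (β (j + 1) - b) i ^ 2 = 0 :=
    le_antisymm (nonpos_of_mul_nonpos_right hD (by positivity))
      (Finset.sum_nonneg fun _ _ => sq_nonneg _)
  have heq : β (j + 1) = b := by
    ext i
    have := (Finset.sum_eq_zero_iff_of_nonneg fun i _ => sq_nonneg _).1 hD0 i (Finset.mem_univ i)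
    have := (pow_eq_zero_iff two_ne_zero).1 this
    simpa [sub_eq_zero] using this
  refine ⟨heq, fun i => ?_⟩
  rw [heq]
  by_cases hi : i ∈ supp βs
  · -- the oracle error is smaller than the smallest signal
    have h1 : ρ 1 * |b i - βs i| < ρ 1 * |βs i| := by
      have h2 : ρ 1 * |b i - βs i| ≤ ρ 3 * constK'' K M βs :=
        mul_le_mul (h12.trans h23) (hK'' i hi) (abs_nonneg _) (by linarith)
      have h3 : ρ 1 * minAbs βs ≤ ρ 1 * |βs i| :=
        mul_le_mul_of_nonneg_left (minAbs_le hi) (by linarith)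
      have h4 : ρ 3 * constK'' K M βs ≤ 1 := by
        have : 0 ≤ ρ 3 * constK'' K M βs := mul_nonneg (by linarith) hK0
        nlinarith
      linarith
    have h2 : |b i - βs i| < |βs i| := lt_of_mul_lt_mul_left h1 (by linarith)
    rcases lt_or_gt_of_ne (mem_supp.1 hi) with h | h
    · rw [abs_of_neg h] at h2
      have := (abs_lt.1 h2).2
      rw [sign_neg h, sign_neg (by linarith)]
    · rw [abs_of_pos h] at h2
      have := (abs_lt.1 h2).1
      rw [sign_pos h, sign_pos (by linarith)]
  · rw [hbout i hi]
    have : βs i = 0 := by simpa [mem_supp] using hi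
    rw [this]

end Relaxation

/-! ### Products of sub-Gaussian variables -/

section SubGaussian

variable {Ω : Type*} [MeasurableSpace Ω] {μ : Measure Ω}

lemma hasSubgaussianMGF_mono {U : Ω → ℝ} {c d : ℝ≥0} (h : HasSubgaussianMGF U c μ)
    (hcd : c ≤ d) : HasSubgaussianMGF U d μ where
  integrable_exp_mul := h.integrable_exp_mul
  mgf_le t := (h.mgf_le t).trans (by
    have : (c : ℝ) ≤ d := hcd
    gcongr)

lemma hasSubgaussianMGF_const_mul {U : Ω → ℝ} {c : ℝ≥0} (h : HasSubgaussianMGF U c μ) (r : ℝ) :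
    HasSubgaussianMGF (fun ω => r * U ω) ((r ^ 2).toNNReal * c) μ := by
  rw [Real.toNNReal_of_nonneg (sq_nonneg r)]
  exact h.const_mul r

lemma memLp_two_of_hasSubgaussianMGF {U : Ω → ℝ} {c : ℝ≥0} (h : HasSubgaussianMGF U c μ) :
    MemLp U 2 μ := by
  simpa using h.memLp 2

lemma lintegral_exp_sq_div_four_gaussian :
    ∫⁻ x, ENNReal.ofReal (Real.exp (x ^ 2 / 4)) ∂(gaussianReal 0 1) = ENNReal.ofReal √2 := by
  rw [gaussianReal_of_var_ne_zero 0 one_ne_zero,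
    lintegral_withDensity_eq_lintegral_mul _ (measurable_gaussianPDF 0 1) (by fun_prop)]
  have h : ∀ x : ℝ, (gaussianPDF 0 1 * fun x => ENNReal.ofReal (Real.exp (x ^ 2 / 4))) x =
      ENNReal.ofReal ((√(2 * Real.pi))⁻¹ * Real.exp (-(1 / 4) * x ^ 2)) := fun x => by
    rw [Pi.mul_apply, gaussianPDF, ← ENNReal.ofReal_mul (gaussianPDFReal_nonneg _ _ _),
      gaussianPDFReal, mul_assoc, ← Real.exp_add]
    congr 3
    · simp
    · simp; ring
  simp_rw [h]
  rw [← ofReal_integral_eq_lintegral_ofReal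
    ((integrable_exp_neg_mul_sq (by norm_num : (0 : ℝ) < 1 / 4)).const_mul _)
    (ae_of_all _ fun x => by positivity), integral_const_mul, integral_gaussian]
  congr 1
  have h2 : Real.pi / (1 / 4) = 2 * Real.pi * 2 := by ring
  rw [h2, Real.sqrt_mul (by positivity) 2, ← mul_assoc, inv_mul_cancel₀ (by positivity), one_mul]

/-- The square of a sub-Gaussian variable has an exponential moment. The Gaussian integral
`exp (u² / 2) = 𝔼 exp (u g)` linearizes the square and Tonelli's theorem reduces the claim to the
moment generating function of `U`. -/
lemma exp_sq_div_le {U : Ω → ℝ} [SFinite μ] (hU : Measurable U) {t : ℝ≥0} (ht : 0 < t)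
    (h : HasSubgaussianMGF U t μ) :
    Integrable (fun ω => Real.exp (U ω ^ 2 / (4 * t))) μ ∧
      ∫ ω, Real.exp (U ω ^ 2 / (4 * t)) ∂μ ≤ 2 := by
  have ht' : (0 : ℝ) < t := ht
  set r : ℝ := (√(2 * t))⁻¹ with hr
  have hr2 : r ^ 2 = 1 / (2 * t) := by
    rw [hr, inv_pow, Real.sq_sqrt (by positivity), one_div]
  have h1 : ∀ ω, ENNReal.ofReal (Real.exp (U ω ^ 2 / (4 * t))) =
      ∫⁻ g, ENNReal.ofReal (Real.exp (r * U ω * g)) ∂(gaussianReal 0 1) := fun ω => by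
    rw [← ofReal_integral_eq_lintegral_ofReal (integrable_exp_mul_gaussianReal (r * U ω))
      (ae_of_all _ fun x => by positivity)]
    have := mgf_gaussianReal (p := gaussianReal 0 1) (X := id) (μ := 0) (v := 1)
      Measure.map_id (r * U ω)
    simp only [mgf, id] at this
    rw [this, mul_pow, hr2]
    congr 2
    push_cast
    field_simp
    ring
  have h2 : ∫⁻ ω, ENNReal.ofReal (Real.exp (U ω ^ 2 / (4 * t))) ∂μ ≤ ENNReal.ofReal √2 := by
    simp_rw [h1]
    rw [lintegral_lintegral_swap (by fun_prop), ← lintegral_exp_sq_div_four_gaussian]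
    refine lintegral_mono fun g => ?_
    have h3 := h.integrable_exp_mul (r * g)
    have h4 : ∀ ω, r * U ω * g = r * g * U ω := fun ω => by ring
    simp_rw [h4]
    rw [← ofReal_integral_eq_lintegral_ofReal h3 (ae_of_all _ fun x => by positivity)]
    refine ENNReal.ofReal_le_ofReal ((h.mgf_le (r * g)).trans_eq ?_)
    rw [mul_pow, hr2]
    congr 1
    field_simp
    ring
  have hmeas : AEStronglyMeasurable (fun ω => Real.exp (U ω ^ 2 / (4 * t))) μ := by fun_prop
  have hint : Integrable (fun ω => Real.exp (U ω ^ 2 / (4 * t))) μ := by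
    refine ⟨hmeas, ?_⟩
    rw [hasFiniteIntegral_iff_ofReal (ae_of_all _ fun x => by positivity)]
    exact h2.trans_lt ENNReal.ofReal_lt_top
  refine ⟨hint, ?_⟩
  rw [← ofReal_integral_eq_lintegral_ofReal hint (ae_of_all _ fun x => by positivity)] at h2
  have h5 := (ENNReal.ofReal_le_ofReal_iff (Real.sqrt_nonneg 2)).1 h2
  exact h5.trans (Real.sqrt_le_iff.2 (by norm_num))

lemma exp_le_one_add_add_sq (y : ℝ) : Real.exp y ≤ 1 + y + y ^ 2 * Real.exp |y| := by
  rcases le_total 0 y with hy | hy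
  · rw [abs_of_nonneg hy]
    have h1 : Real.exp y - 1 ≤ y * Real.exp y := by
      have := Real.add_one_le_exp (-y)
      have h2 : Real.exp y * Real.exp (-y) = 1 := by rw [← Real.exp_add]; simp
      nlinarith [Real.exp_pos y]
    nlinarith
  · have hE : 1 ≤ Real.exp |y| := Real.one_le_exp (abs_nonneg y)
    have h3 : y ^ 2 ≤ y ^ 2 * Real.exp |y| := by nlinarith [sq_nonneg y]
    rcases le_total (-1) y with h1 | h1
    · have := (abs_le.1 (Real.abs_exp_sub_one_sub_id_le (abs_le.2 ⟨h1, by linarith⟩))).2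
      linarith
    · have := Real.exp_le_one_iff.2 hy
      nlinarith

lemma exp_mul_le {r : ℝ} (hr : |r| ≤ 1 / 2) (x : ℝ) :
    Real.exp (r * x) ≤ 1 + r * x + 8 * r ^ 2 * Real.exp |x| := by
  refine (exp_le_one_add_add_sq _).trans ?_
  have h1 : Real.exp |r * x| ≤ Real.exp (|x| / 2) := by
    rw [abs_mul]
    exact Real.exp_le_exp.2 (by nlinarith [abs_nonneg x])
  have h2 : |x| ^ 2 ≤ 8 * Real.exp (|x| / 2) := by
    have := Real.quadratic_le_exp_of_nonneg (by positivity : 0 ≤ |x| / 2)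
    nlinarith [abs_nonneg x]
  have h3 : Real.exp |x| = Real.exp (|x| / 2) * Real.exp (|x| / 2) := by
    rw [← Real.exp_add]; congr 1; ring
  rw [sq_abs] at h2
  have h4 : (r * x) ^ 2 * Real.exp |r * x| ≤ r ^ 2 * (8 * Real.exp (|x| / 2)) *
      Real.exp (|x| / 2) := by
    rw [mul_pow]; gcongr
  rw [h3]
  linarith

lemma integral_sq_le {U : Ω → ℝ} [IsProbabilityMeasure μ] (hU : Measurable U) {t : ℝ≥0}
    (ht : 0 < t) (h : HasSubgaussianMGF U t μ) : ∫ ω, U ω ^ 2 ∂μ ≤ 8 * t := by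
  have ht' : (0 : ℝ) < t := ht
  obtain ⟨h1, h2⟩ := exp_sq_div_le hU ht h
  have h3 : ∀ ω, U ω ^ 2 ≤ 4 * t * Real.exp (U ω ^ 2 / (4 * t)) := fun ω => by
    have := Real.add_one_le_exp (U ω ^ 2 / (4 * t))
    rw [mul_comm, ← div_le_iff₀ (by positivity)]
    linarith
  have h4 := integral_mono_of_nonneg (ae_of_all _ fun ω => sq_nonneg (U ω)) (h1.const_mul _)
    (ae_of_all _ h3)
  rw [integral_const_mul] at h4
  nlinarith

/-- A centred product of sub-Gaussian variables is sub-exponential. -/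
lemma mgf_mul_sub_le [IsProbabilityMeasure μ] {U V : Ω → ℝ} (hU : Measurable U)
    (hV : Measurable V) {t : ℝ≥0} (ht : 0 < t) (hUt : HasSubgaussianMGF U t μ)
    (hVt : HasSubgaussianMGF V t μ) {u : ℝ} (hu : |u| ≤ 1 / (8 * t)) :
    Integrable (fun ω => Real.exp (u * (U ω * V ω - ∫ ω', U ω' * V ω' ∂μ))) μ ∧
      mgf (fun ω => U ω * V ω - ∫ ω', U ω' * V ω' ∂μ) μ u ≤
        Real.exp (2048 * t ^ 2 * u ^ 2) := by
  have ht' : (0 : ℝ) < t := ht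
  set m := ∫ ω', U ω' * V ω' ∂μ with hm
  set W : Ω → ℝ := fun ω => U ω * V ω - m with hW
  set P : Ω → ℝ := fun ω => Real.exp (U ω ^ 2 / (4 * t)) with hP
  set Q : Ω → ℝ := fun ω => Real.exp (V ω ^ 2 / (4 * t)) with hQ
  obtain ⟨hPi, hP2⟩ := exp_sq_div_le hU ht hUt
  obtain ⟨hQi, hQ2⟩ := exp_sq_div_le hV ht hVt
  have hU2 := memLp_two_of_hasSubgaussianMGF hUt
  have hV2 := memLp_two_of_hasSubgaussianMGF hVt
  have hUV : Integrable (fun ω => U ω * V ω) μ := hU2.integrable_mul hV2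
  have habs : ∀ x y : ℝ, |x * y| ≤ (x ^ 2 + y ^ 2) / 2 := fun x y => by
    rw [abs_mul, ← sq_abs x, ← sq_abs y]
    nlinarith [sq_nonneg (|x| - |y|)]
  have hm8 : |m| ≤ 8 * t := by
    have h1 : |m| ≤ ∫ ω, |U ω * V ω| ∂μ := abs_integral_le_integral_abs
    have h2 : ∫ ω, |U ω * V ω| ∂μ ≤ ∫ ω, (U ω ^ 2 + V ω ^ 2) / 2 ∂μ :=
      integral_mono hUV.abs ((hU2.integrable_sq.add hV2.integrable_sq).div_const 2) fun ω => habs _ _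
    rw [integral_div, integral_add hU2.integrable_sq hV2.integrable_sq] at h2
    linarith [integral_sq_le hU ht hUt, integral_sq_le hV ht hVt]
  have hE2 : Real.exp 2 ≤ 8 := by
    have h1 : Real.exp 2 = Real.exp 1 * Real.exp 1 := by rw [← Real.exp_add]; norm_num
    have := Real.exp_one_lt_d9
    have h0 := Real.exp_pos 1
    rw [h1]; nlinarith
  have hbound : ∀ ω, Real.exp |W ω / (4 * t)| ≤ 4 * (P ω + Q ω) := fun ω => by
    set x := U ω ^ 2 / (8 * (t : ℝ)) with hx
    set y := V ω ^ 2 / (8 * (t : ℝ)) with hy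
    have h1 : |W ω / (4 * t)| ≤ x + y + 2 := by
      rw [abs_div, abs_of_pos (by positivity : (0 : ℝ) < 4 * t), div_le_iff₀ (by positivity)]
      have h2 : |W ω| ≤ |U ω * V ω| + |m| := abs_sub _ _
      have h3 := habs (U ω) (V ω)
      have h4 : (x + y + 2) * (4 * t) = (U ω ^ 2 + V ω ^ 2) / 2 + 8 * t := by
        rw [hx, hy]; field_simp; ring
      linarith
    have hPx : P ω = Real.exp x ^ 2 := by
      have h2 : U ω ^ 2 / (4 * (t : ℝ)) = (2 : ℕ) * x := by
        rw [hx]; push_cast; field_simp; ring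
      simp only [hP]
      rw [h2, Real.exp_nat_mul]
    have hQy : Q ω = Real.exp y ^ 2 := by
      have h2 : V ω ^ 2 / (4 * (t : ℝ)) = (2 : ℕ) * y := by
        rw [hy]; push_cast; field_simp; ring
      simp only [hQ]
      rw [h2, Real.exp_nat_mul]
    calc Real.exp |W ω / (4 * t)| ≤ Real.exp (x + y + 2) := Real.exp_le_exp.2 h1
      _ = Real.exp x * Real.exp y * Real.exp 2 := by rw [Real.exp_add, Real.exp_add]
      _ ≤ Real.exp x * Real.exp y * 8 := by gcongr
      _ ≤ 4 * (P ω + Q ω) := by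
        rw [hPx, hQy]; nlinarith [sq_nonneg (Real.exp x - Real.exp y)]
  -- rescaled so that `exp_mul_le` applies
  set r := 4 * t * u with hr
  have hr2 : |r| ≤ 1 / 2 := by
    rw [hr, abs_mul, abs_of_pos (by positivity : (0 : ℝ) < 4 * t)]
    have := mul_le_mul_of_nonneg_left hu (by positivity : (0 : ℝ) ≤ 4 * t)
    refine this.trans_eq ?_
    field_simp; norm_num
  have hrW : ∀ ω, u * W ω = r * (W ω / (4 * t)) := fun ω => by rw [hr]; field_simp
  have hpt : ∀ ω, Real.exp (u * W ω) ≤ 1 + u * W ω + 32 * r ^ 2 * (P ω + Q ω) := fun ω => by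
    have h1 := exp_mul_le hr2 (W ω / (4 * t))
    rw [← hrW] at h1
    have h2 := mul_le_mul_of_nonneg_left (hbound ω) (by positivity : 0 ≤ 8 * r ^ 2)
    linarith
  have hWi : Integrable W μ := hUV.sub (integrable_const m)
  have hW0 : ∫ ω, W ω ∂μ = 0 := by
    rw [hW, integral_sub hUV (integrable_const m), integral_const]
    simp [hm]
  have hWu : Integrable (fun ω => u * W ω) μ := hWi.const_mul u
  have hWu1 : Integrable (fun ω => 1 + u * W ω) μ := (integrable_const 1).add hWu
  have hPQ : Integrable (fun ω => 32 * r ^ 2 * (P ω + Q ω)) μ := (hPi.add hQi).const_mul _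
  have hdom : Integrable (fun ω => 1 + u * W ω + 32 * r ^ 2 * (P ω + Q ω)) μ := hWu1.add hPQ
  have hint : Integrable (fun ω => Real.exp (u * W ω)) μ := by
    refine hdom.mono' (by fun_prop) (ae_of_all _ fun ω => ?_)
    rw [Real.norm_of_nonneg (Real.exp_pos _).le]
    exact hpt ω
  refine ⟨hint, ?_⟩
  have h1 : mgf W μ u ≤ ∫ ω, (1 + u * W ω + 32 * r ^ 2 * (P ω + Q ω)) ∂μ :=
    integral_mono hint hdom hpt
  rw [integral_add hWu1 hPQ, integral_add (integrable_const 1) hWu, integral_const_mul,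
    integral_const_mul, integral_add (f := P) (g := Q) hPi hQi, hW0, integral_const] at h1
  simp only [probReal_univ, smul_eq_mul, mul_one, mul_zero, add_zero] at h1
  have h2 : 32 * r ^ 2 * (∫ ω, P ω ∂μ + ∫ ω, Q ω ∂μ) ≤ 32 * r ^ 2 * 4 := by
    gcongr; linarith
  have h3 : 32 * r ^ 2 * 4 = 2048 * t ^ 2 * u ^ 2 := by rw [hr]; ring
  have h4 := Real.add_one_le_exp (2048 * (t : ℝ) ^ 2 * u ^ 2)
  linarith

/-- Chernoff's bound for a sum of independent variables whose moment generating functions are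
dominated by a Gaussian one at the relevant point. -/
lemma measure_sum_ge_le [IsProbabilityMeasure μ] {n : ℕ} {W : Fin n → Ω → ℝ}
    (hindep : iIndepFun W μ) (hmeas : ∀ i, Measurable (W i)) {u B δ : ℝ} (hu : 0 ≤ u)
    (hint : ∀ i, Integrable (fun ω => Real.exp (u * W i ω)) μ)
    (hmgf : ∀ i, mgf (W i) μ u ≤ Real.exp B) :
    μ.real {ω | n * δ ≤ ∑ i, W i ω} ≤ Real.exp (-(n * (u * δ - B))) := by
  have h1 := measure_ge_le_exp_mul_mgf (μ := μ) (X := ∑ i, W i) (n * δ) hu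
    (hindep.integrable_exp_mul_sum hmeas fun i _ => hint i)
  rw [hindep.mgf_sum hmeas] at h1
  simp only [Finset.sum_apply] at h1
  refine h1.trans ?_
  have h2 : ∏ i, mgf (W i) μ u ≤ ∏ _i : Fin n, Real.exp B :=
    Finset.prod_le_prod (fun i _ => mgf_nonneg) fun i _ => hmgf i
  rw [Finset.prod_const, Finset.card_univ, Fintype.card_fin, ← Real.exp_nat_mul] at h2
  refine (mul_le_mul_of_nonneg_left h2 (Real.exp_pos _).le).trans_eq ?_
  rw [← Real.exp_add]
  congr 1
  ring

/-- Bernstein-type concentration of an empirical second moment. -/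
lemma measure_sum_mul_sub_ge_le [IsProbabilityMeasure μ] {n : ℕ} {U V : Fin n → Ω → ℝ}
    (hU : ∀ i, Measurable (U i)) (hV : ∀ i, Measurable (V i))
    (hindep : iIndepFun (fun i ω => (U i ω, V i ω)) μ) {t : ℝ≥0} (ht : 1 ≤ t)
    (hUt : ∀ i, HasSubgaussianMGF (U i) t μ) (hVt : ∀ i, HasSubgaussianMGF (V i) t μ)
    {m δ : ℝ} (hm : ∀ i, ∫ ω, U i ω * V i ω ∂μ = m) (hδ : 0 ≤ δ) (hδ1 : δ ≤ 1) :
    μ.real {ω | n * δ ≤ |∑ i, (U i ω * V i ω - m)|} ≤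
      2 * Real.exp (-(n * (δ ^ 2 / (8192 * t ^ 2)))) := by
  have ht1 : (1 : ℝ) ≤ t := ht
  have ht0 : 0 < t := lt_of_lt_of_le one_pos ht
  -- the minimizer of the Chernoff exponent `2048 t² u² - u δ`
  set u : ℝ := δ / (4096 * t ^ 2) with hu
  have hu0 : 0 ≤ u := by positivity
  have hut : u ≤ 1 / (8 * t) := by
    rw [hu, div_le_div_iff₀ (by positivity) (by positivity)]
    nlinarith
  have hexp : u * δ - 2048 * t ^ 2 * u ^ 2 = δ ^ 2 / (8192 * t ^ 2) := by
    rw [hu]; field_simp; ring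
  have hW : ∀ s : ℝ, iIndepFun (fun i ω => s * (U i ω * V i ω - m)) μ := fun s =>
    hindep.comp (fun _ q => s * (q.1 * q.2 - m)) fun _ => by fun_prop
  have hside : ∀ s : ℝ, |s| = 1 → μ.real {ω | n * δ ≤ ∑ i, s * (U i ω * V i ω - m)} ≤
      Real.exp (-(n * (δ ^ 2 / (8192 * t ^ 2)))) := fun s hs => by
    have key : ∀ i, Integrable (fun ω => Real.exp (u * (s * (U i ω * V i ω - m)))) μ ∧
        mgf (fun ω => s * (U i ω * V i ω - m)) μ u ≤ Real.exp (2048 * t ^ 2 * u ^ 2) := fun i => by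
      have hsu : |u * s| ≤ 1 / (8 * t) := by
        rw [abs_mul, hs, mul_one, abs_of_nonneg hu0]; exact hut
      have h1 := mgf_mul_sub_le (hU i) (hV i) ht0 (hUt i) (hVt i) hsu
      rw [hm] at h1
      have hs2 : (u * s) ^ 2 = u ^ 2 := by
        rw [mul_pow, ← sq_abs s, hs, one_pow, mul_one]
      rw [hs2] at h1
      simp only [mgf, mul_assoc] at h1 ⊢
      exact h1
    have h2 := measure_sum_ge_le (hW s) (fun i => by fun_prop) (δ := δ) hu0
      (fun i => (key i).1) fun i => (key i).2
    rwa [hexp] at h2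
  have h1 := hside 1 abs_one
  have h2 := hside (-1) (by simp)
  rw [two_mul]
  refine (measureReal_mono (fun ω hω => ?_)).trans
    ((measureReal_union_le _ _).trans (add_le_add h1 h2))
  rcases le_abs'.1 (show n * δ ≤ |∑ i, (U i ω * V i ω - m)| from hω) with h | h
  · right
    simp only [Set.mem_ofPred_eq, ← Finset.mul_sum]
    linarith
  · left
    simpa only [Set.mem_ofPred_eq, one_mul] using h

/-- Concentration of a linear form in independent sub-Gaussian variables. -/
lemma measure_abs_sum_mul_ge_le [IsProbabilityMeasure μ] {n : ℕ} {V : Fin n → Ω → ℝ}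
    (hindep : iIndepFun V μ) {c : ℝ≥0} (hV : ∀ i, HasSubgaussianMGF (V i) c μ)
    {x : Fin n → ℝ} {B : ℝ≥0} {δ : ℝ} (hx : ∑ i, x i ^ 2 ≤ n * B) (hc : 0 < c) (hB : 0 < B) (hn : 0 < n)
    (hδ : 0 ≤ δ) :
    μ.real {ω | n * δ ≤ |∑ i, x i * V i ω|} ≤
      2 * Real.exp (-(n * (δ ^ 2 / (2 * (B * c))))) := by
  have hc' : (0 : ℝ) < c := hc
  have hside : ∀ s : ℝ, s ^ 2 = 1 → μ.real {ω | n * δ ≤ ∑ i, s * (x i * V i ω)} ≤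
      Real.exp (-(n * (δ ^ 2 / (2 * (B * c))))) := fun s hs => by
    have h1 : iIndepFun (fun i ω => s * (x i * V i ω)) μ :=
      hindep.comp (fun i y => s * (x i * y)) fun i => by fun_prop
    have h2 := HasSubgaussianMGF.sum_of_iIndepFun h1 (s := Finset.univ)
      (c := fun i => (s ^ 2).toNNReal * ((x i ^ 2).toNNReal * c))
      fun i _ => hasSubgaussianMGF_const_mul (hasSubgaussianMGF_const_mul (hV i) (x i)) s
    have h3 : ∑ i, (s ^ 2).toNNReal * ((x i ^ 2).toNNReal * c) ≤ n * (B * c) := by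
      rw [← NNReal.coe_le_coe]
      push_cast
      simp only [hs, Real.coe_toNNReal _ zero_le_one, Real.coe_toNNReal _ (sq_nonneg _), one_mul,
        ← Finset.sum_mul]
      calc (∑ i, x i ^ 2) * (c : ℝ) ≤ n * B * c := by gcongr
        _ = _ := by ring
    have h4 := (hasSubgaussianMGF_mono h2 h3).measure_ge_le (ε := n * δ) (by positivity)
    refine h4.trans_eq ?_
    congr 1
    push_cast
    have : (n : ℝ) ≠ 0 := by positivity
    have : (B : ℝ) ≠ 0 := by positivity
    field_simp
  have h1 := hside 1 (by norm_num)
  have h2 := hside (-1) (by norm_num)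
  rw [two_mul]
  refine (measureReal_mono (fun ω hω => ?_)).trans
    ((measureReal_union_le _ _).trans (add_le_add h1 h2))
  rcases le_abs'.1 (show n * δ ≤ |∑ i, x i * V i ω| from hω) with h | h
  · right
    simp only [Set.mem_ofPred_eq, ← Finset.mul_sum]
    linarith
  · left
    simpa only [Set.mem_ofPred_eq, one_mul] using h

end SubGaussian

/-! ### Conditioning on an independent variable -/

section Conditioning

variable {Ω α β γ : Type*} [MeasurableSpace Ω] [MeasurableSpace α] [MeasurableSpace β]
  [MeasurableSpace γ] {μ : Measure Ω}

/-- A bound which holds with the first variable frozen at any value holds for the joint law. -/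
lemma measure_le_of_indepFun [IsProbabilityMeasure μ] {U : Ω → α} {V : Ω → β} (hU : Measurable U)
    (hV : Measurable V) (h : IndepFun U V μ) {S : Set (α × β)} (hS : MeasurableSet S) {r : ℝ}
    (hr : ∀ u, μ.real {ω | (u, V ω) ∈ S} ≤ r) : μ.real {ω | (U ω, V ω) ∈ S} ≤ r := by
  have : IsProbabilityMeasure (μ.map U) := Measure.isProbabilityMeasure_map hU.aemeasurable
  have : IsProbabilityMeasure (μ.map V) := Measure.isProbabilityMeasure_map hV.aemeasurable
  have hr0 : 0 ≤ r := by
    obtain ⟨ω⟩ := μ.nonempty_of_neZero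
    exact measureReal_nonneg.trans (hr (U ω))
  have hlaw := (indepFun_iff_map_prod_eq_prod_map_map hU.aemeasurable hV.aemeasurable).1 h
  have hle : μ {ω | (U ω, V ω) ∈ S} ≤ ENNReal.ofReal r := by
    calc μ {ω | (U ω, V ω) ∈ S} = μ.map (fun ω => (U ω, V ω)) S :=
          (Measure.map_apply (hU.prodMk hV) hS).symm
      _ = ∫⁻ u, μ.map V (Prod.mk u ⁻¹' S) ∂(μ.map U) := by
          rw [hlaw, Measure.prod_apply hS]
      _ ≤ ∫⁻ _, ENNReal.ofReal r ∂(μ.map U) := by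
          refine lintegral_mono fun u => ?_
          rw [Measure.map_apply hV (measurable_prodMk_left hS)]
          exact (ENNReal.le_ofReal_iff_toReal_le (measure_ne_top _ _) hr0).2 (hr u)
      _ = ENNReal.ofReal r := by simp
  exact ENNReal.toReal_le_of_le_ofReal hr0 hle

lemma indepFun_prodMk_of_indepFun [IsProbabilityMeasure μ] {X : Ω → α} {A : Ω → β} {ε : Ω → γ}
    (hX : Measurable X) (hA : Measurable A) (hε : Measurable ε)
    (h : IndepFun X (fun ω => (A ω, ε ω)) μ) (h' : IndepFun A ε μ) :
    IndepFun (fun ω => (X ω, A ω)) ε μ := by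
  have hXA : IndepFun X A μ := h.comp measurable_id measurable_fst
  have : IsProbabilityMeasure (μ.map X) := Measure.isProbabilityMeasure_map hX.aemeasurable
  have : IsProbabilityMeasure (μ.map A) := Measure.isProbabilityMeasure_map hA.aemeasurable
  have : IsProbabilityMeasure (μ.map ε) := Measure.isProbabilityMeasure_map hε.aemeasurable
  rw [indepFun_iff_map_prod_eq_prod_map_map (by fun_prop) (by fun_prop)] at h h' hXA ⊢
  rw [hXA]
  apply MeasurableEquiv.prodAssoc.map_measurableEquiv_injective
  rw [Measure.prodAssoc_prod, ← h', ← h, Measure.map_map (by fun_prop) (by fun_prop)]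
  rfl

end Conditioning

/-! ### From entrywise deviations to the deterministic conditions -/

section Deviation

open scoped MatrixOrder

variable {n p : ℕ}

lemma gram_nonneg (X : Matrix (Fin n) (Fin p) ℝ) : 0 ≤ gram X := by
  rw [Matrix.nonneg_iff_posSemidef, gram, ← conjTranspose_eq_transpose_of_trivial]
  exact (posSemidef_conjTranspose_mul_self X).smul (by positivity)

lemma sigHat_isSelfAdjoint (X A : Matrix (Fin n) (Fin p) ℝ) {SigA : Matrix (Fin p) (Fin p) ℝ}
    (hSig : IsSelfAdjoint SigA) : IsSelfAdjoint (sigHat X A SigA) :=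
  (IsSelfAdjoint.of_nonneg (gram_nonneg (X + A))).sub hSig

/-- The surrogate Gram matrix has no eigenvalue below `-λ_max(Σ_A)`. -/
lemma neg_lamMax_le_sigHat (X A : Matrix (Fin n) (Fin p) ℝ) {SigA : Matrix (Fin p) (Fin p) ℝ}
    (hSig : IsSelfAdjoint SigA) : algebraMap ℝ _ (-lamMax SigA) ≤ sigHat X A SigA := by
  rw [map_neg, sigHat, sub_eq_add_neg]
  exact (neg_le_neg (le_algebraMap_lamMax hSig)).trans (le_add_of_nonneg_left (gram_nonneg _))

lemma abs_dotProduct_mulVec_le {D : Matrix (Fin p) (Fin p) ℝ} {d : ℝ} (hD : ∀ j k, |D j k| ≤ d)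
    (u : Fin p → ℝ) : |u ⬝ᵥ (D *ᵥ u)| ≤ d * (∑ i, |u i|) ^ 2 := by
  have h1 : ∀ j, |(D *ᵥ u) j| ≤ d * ∑ k, |u k| := fun j => by
    rw [mulVec, dotProduct, Finset.mul_sum]
    refine (Finset.abs_sum_le_sum_abs _ _).trans (Finset.sum_le_sum fun k _ => ?_)
    rw [abs_mul]
    exact mul_le_mul_of_nonneg_right (hD j k) (abs_nonneg _)
  calc |u ⬝ᵥ (D *ᵥ u)| ≤ ∑ j, |u j * (D *ᵥ u) j| := Finset.abs_sum_le_sum_abs _ _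
    _ ≤ ∑ j, |u j| * (d * ∑ k, |u k|) := Finset.sum_le_sum fun j _ => by
        rw [abs_mul]
        exact mul_le_mul_of_nonneg_left (h1 j) (abs_nonneg _)
    _ = _ := by rw [← Finset.sum_mul]; ring

lemma sq_l1Norm_le_of_mem_cone {S : Finset (Fin p)} {u : Fin p → ℝ} (hu : u ∈ cone S) :
    (∑ i, |u i|) ^ 2 ≤ 24 * S.card * ∑ i, u i ^ 2 := by
  obtain ⟨T, -, hT, hcone⟩ := hu
  have h1 : ∑ i, |u i| ≤ 4 * ∑ i ∈ T, |u i| := by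
    rw [← Finset.sum_add_sum_compl T]; linarith
  have h2 : (∑ i ∈ T, |u i|) ^ 2 ≤ T.card * ∑ i, u i ^ 2 := by
    refine (sq_sum_le_card_mul_sum_sq (s := T) (f := fun i => |u i|)).trans ?_
    refine mul_le_mul_of_nonneg_left ?_ (Nat.cast_nonneg _)
    simp only [sq_abs]
    exact Finset.sum_le_sum_of_subset_of_nonneg (Finset.subset_univ _) fun _ _ _ => sq_nonneg _
  calc (∑ i, |u i|) ^ 2 ≤ (4 * ∑ i ∈ T, |u i|) ^ 2 := by gcongr
    _ = 16 * (∑ i ∈ T, |u i|) ^ 2 := by ring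
    _ ≤ 16 * (T.card * ∑ i, u i ^ 2) := by gcongr
    _ ≤ 16 * (3 / 2 * S.card * ∑ i, u i ^ 2) := by gcongr
    _ = _ := by ring

variable {X A : Fin n → Fin p → ℝ} {ε : Fin n → ℝ} {b : Fin p → ℝ}
  {SigA : Matrix (Fin p) (Fin p) ℝ} {δ : ℝ}

lemma abs_sigHat_sub_gram_le (hn : 0 < n)
    (hAA : ∀ j k, |∑ i, (A i j * A i k - SigA j k)| ≤ n * δ)
    (hXA : ∀ j k, |∑ i, X i j * A i k| ≤ n * δ) (j k : Fin p) :
    |(sigHat (of X) (of A) SigA - gram (of X)) j k| ≤ 3 * δ := by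
  have hn' : (0 : ℝ) < n := by exact_mod_cast hn
  have h : (sigHat (of X) (of A) SigA - gram (of X)) j k =
      (∑ i, X i j * A i k + ∑ i, X i k * A i j + ∑ i, (A i j * A i k - SigA j k)) / n := by
    simp only [sigHat, gram, Matrix.sub_apply, Matrix.smul_apply, mul_apply, transpose_apply,
      Matrix.add_apply, of_apply, smul_eq_mul, Finset.sum_sub_distrib, Finset.sum_const, Finset.card_univ,
      Fintype.card_fin, nsmul_eq_mul, add_mul, mul_add, Finset.sum_add_distrib]
    have h2 : ∑ i, X i k * A i j = ∑ i, A i j * X i k :=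
      Finset.sum_congr rfl fun i _ => mul_comm _ _
    rw [h2]
    field_simp
    ring
  rw [h, abs_div, abs_of_pos hn', div_le_iff₀ hn']
  have h1 := abs_add_three (∑ i, X i j * A i k) (∑ i, X i k * A i j)
    (∑ i, (A i j * A i k - SigA j k))
  linarith [hAA j k, hXA j k, hXA k j]

lemma abs_xiHat_sub_le (hn : 0 < n)
    (hAA : ∀ j k, |∑ i, (A i j * A i k - SigA j k)| ≤ n * δ)
    (hXA : ∀ j k, |∑ i, X i j * A i k| ≤ n * δ)
    (hZε : ∀ j, |∑ i, (X i j + A i j) * ε i| ≤ n * δ) (j : Fin p) :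
    |(xiHat (of X) (of A) ε b - sigHat (of X) (of A) SigA *ᵥ b) j| ≤ δ + 2 * δ * l1Norm b := by
  have hn' : (0 : ℝ) < n := by exact_mod_cast hn
  set N : Matrix (Fin p) (Fin p) ℝ := (1 / (n : ℝ)) • ((of X + of A)ᵀ * of A) - SigA with hN
  have hsplit : xiHat (of X) (of A) ε b - sigHat (of X) (of A) SigA *ᵥ b =
      (1 / (n : ℝ)) • ((of X + of A)ᵀ *ᵥ ε) - N *ᵥ b := by
    rw [hN, xiHat, sigHat, gram, sub_mulVec, sub_mulVec, smul_mulVec, smul_mulVec,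
      ← mulVec_mulVec, ← mulVec_mulVec, mulVec_add, add_mulVec, mulVec_add, smul_add, smul_add]
    abel
  have hNe : ∀ k, |N j k| ≤ 2 * δ := fun k => by
    have h : N j k = (∑ i, X i j * A i k + ∑ i, (A i j * A i k - SigA j k)) / n := by
      simp only [hN, Matrix.sub_apply, Matrix.smul_apply, mul_apply, transpose_apply,
        Matrix.add_apply, of_apply, smul_eq_mul, Finset.sum_sub_distrib, Finset.sum_const, Finset.card_univ,
        Fintype.card_fin, nsmul_eq_mul, add_mul, Finset.sum_add_distrib]
      field_simp
      ring
    rw [h, abs_div, abs_of_pos hn', div_le_iff₀ hn']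
    have h1 := abs_add_le (∑ i, X i j * A i k) (∑ i, (A i j * A i k - SigA j k))
    linarith [hAA j k, hXA j k]
  have hNb : |(N *ᵥ b) j| ≤ 2 * δ * l1Norm b := by
    rw [mulVec, dotProduct, l1Norm, Finset.mul_sum]
    refine (Finset.abs_sum_le_sum_abs _ _).trans (Finset.sum_le_sum fun k _ => ?_)
    rw [abs_mul]
    exact mul_le_mul_of_nonneg_right (hNe k) (abs_nonneg _)
  have hε : |((1 / (n : ℝ)) • ((of X + of A)ᵀ *ᵥ ε)) j| ≤ δ := by
    have h : ((1 / (n : ℝ)) • ((of X + of A)ᵀ *ᵥ ε)) j = (∑ i, (X i j + A i j) * ε i) / n := by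
      simp [mulVec, dotProduct, div_eq_inv_mul]
    rw [h, abs_div, abs_of_pos hn', div_le_iff₀ hn']
    linarith [hZε j]
  rw [hsplit]
  exact (abs_sub _ _).trans (add_le_add hε hNb)

/-- The calibrated matrix inherits half of the restricted eigenvalue constant. -/
lemma calibrated_restricted_eigenvalue (hn : 0 < n) (hSig : IsSelfAdjoint SigA) {κ : ℝ} (e : ℝ)
    {S : Finset (Fin p)} (hδ : 0 ≤ δ) (hκδ : 144 * (S.card * δ) ≤ κ)
    (hREC : REC (gram (of X)) S κ)
    (hAA : ∀ j k, |∑ i, (A i j * A i k - SigA j k)| ≤ n * δ)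
    (hXA : ∀ j k, |∑ i, X i j * A i k| ≤ n * δ) {u : Fin p → ℝ} (hu : u ∈ cone S) :
    κ / 2 * ∑ i, u i ^ 2 ≤ u ⬝ᵥ (calibrated (sigHat (of X) (of A) SigA) e *ᵥ u) := by
  have h1 := hREC.2 u hu
  have h2 := abs_dotProduct_mulVec_le (abs_sigHat_sub_gram_le hn hAA hXA) u
  have h3 := dotProduct_mulVec_mono (le_calibrated (sigHat_isSelfAdjoint (of X) (of A) hSig) e) u
  have h4 := mul_le_mul_of_nonneg_left (sq_l1Norm_le_of_mem_cone hu) (by positivity : 0 ≤ 3 * δ)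
  have h5 : 0 ≤ ∑ i, u i ^ 2 := Finset.sum_nonneg fun _ _ => sq_nonneg _
  have h6 := mul_le_mul_of_nonneg_right hκδ h5
  rw [sub_mulVec, dotProduct_sub] at h2
  have h7 := (abs_le.1 h2).1
  linarith

/-- The calibration costs at most `(λ_max(Σ_A) + e) ‖β*‖₁ = K / 2`, the remaining half of `K`
absorbs the stochastic deviations. -/
lemma abs_xiHat_sub_calibrated_le (hn : 0 < n) (hSig : IsSelfAdjoint SigA) {e : ℝ} (he : 0 ≤ e)
    (hl : 0 ≤ lamMax SigA) (hδ1 : δ ≤ lamMax SigA / 4) (hδ2 : δ ≤ lamMax SigA / 4 * l1Norm b)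
    (hAA : ∀ j k, |∑ i, (A i j * A i k - SigA j k)| ≤ n * δ)
    (hXA : ∀ j k, |∑ i, X i j * A i k| ≤ n * δ)
    (hZε : ∀ j, |∑ i, (X i j + A i j) * ε i| ≤ n * δ) (j : Fin p) :
    |(xiHat (of X) (of A) ε b - calibrated (sigHat (of X) (of A) SigA) e *ᵥ b) j| ≤
      constK SigA e b := by
  set Sh := sigHat (of X) (of A) SigA with hSh
  have hsa : IsSelfAdjoint Sh := sigHat_isSelfAdjoint _ _ hSig
  have hent : ∀ k, |(calibrated Sh e - Sh) j k| ≤ lamMax SigA + e := fun k =>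
    abs_apply_le_of_nonneg_of_le (sub_nonneg.2 (le_calibrated hsa e))
      (calibrated_sub_le hsa he hl (neg_lamMax_le_sigHat _ _ hSig)) j k
  have h1 : |((calibrated Sh e - Sh) *ᵥ b) j| ≤ (lamMax SigA + e) * l1Norm b := by
    rw [mulVec, dotProduct, l1Norm, Finset.mul_sum]
    refine (Finset.abs_sum_le_sum_abs _ _).trans (Finset.sum_le_sum fun k _ => ?_)
    rw [abs_mul]
    exact mul_le_mul_of_nonneg_right (hent k) (abs_nonneg _)
  have h2 := abs_xiHat_sub_le (b := b) hn hAA hXA hZε j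
  have h3 : (xiHat (of X) (of A) ε b - calibrated Sh e *ᵥ b) j =
      (xiHat (of X) (of A) ε b - Sh *ᵥ b) j - ((calibrated Sh e - Sh) *ᵥ b) j := by
    rw [sub_mulVec]; simp
  have h0 : 0 ≤ l1Norm b := Finset.sum_nonneg fun _ _ => abs_nonneg _
  have h4 : 2 * δ * l1Norm b ≤ 2 * (lamMax SigA / 4) * l1Norm b := by gcongr
  have h5 : 0 ≤ lamMax SigA * l1Norm b := mul_nonneg hl h0
  have h6 : 0 ≤ e * l1Norm b := mul_nonneg he h0
  rw [h3, constK]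
  refine (abs_sub _ _).trans ?_
  linarith

end Deviation

lemma exp_neg_le_of_le {B D N δ : ℝ} (hB : 0 < B) (hBD : B ≤ D) (hN : 0 ≤ N) :
    2 * Real.exp (-(N * (δ ^ 2 / B))) ≤ 2 * Real.exp (-(N * (δ ^ 2 / D))) := by
  gcongr

lemma measurableSet_le_and_le {α : Type*} [MeasurableSpace α] {f g f' g' : α → ℝ}
    (hf : Measurable f) (hg : Measurable g) (hf' : Measurable f') (hg' : Measurable g') :
    MeasurableSet {x | f x ≤ g x ∧ f' x ≤ g' x} :=
  (measurableSet_le hf hg).inter (measurableSet_le hf' hg')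

/-! ### Concentration in the additive error model -/

section Model

variable {Ω : Type*} [MeasurableSpace Ω] {μ : Measure Ω} {n p : ℕ}
  {X A : Ω → Fin n → Fin p → ℝ} {ε : Ω → Fin n → ℝ} {SigA : Matrix (Fin p) (Fin p) ℝ}
  {τ σ t : ℝ≥0} {δ : ℝ}

namespace AdditiveErrorModel

lemma subG_A_apply (h : AdditiveErrorModel μ X A ε SigA τ σ) (i : Fin n) (j : Fin p) :
    HasSubgaussianMGF (fun ω => A ω i j) (τ ^ 2) μ := by
  have := h.subG_A i (Pi.single j 1) (by simp [Pi.single_apply])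
  simpa [Pi.single_apply] using this

lemma measurable_A_apply (h : AdditiveErrorModel μ X A ε SigA τ σ) (i : Fin n) (j : Fin p) :
    Measurable fun ω => A ω i j := by
  have := h.measurable_A
  fun_prop

lemma integral_A_mul_A (h : AdditiveErrorModel μ X A ε SigA τ σ) (i : Fin n) (j k : Fin p) :
    ∫ ω, A ω i j * A ω i k ∂μ = SigA j k := by
  have := h.cov_A i j k
  simpa [covariance, h.mean_A] using this

lemma isSelfAdjoint_SigA (h : AdditiveErrorModel μ X A ε SigA τ σ) (hn : 0 < n) :
    IsSelfAdjoint SigA := by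
  ext j k
  rw [Matrix.star_apply, star_trivial, ← h.cov_A ⟨0, hn⟩, ← h.cov_A ⟨0, hn⟩, covariance_comm]

variable [IsProbabilityMeasure μ]

lemma SigA_diag_le (h : AdditiveErrorModel μ X A ε SigA τ σ) (hn : 0 < n) (ht0 : 0 < t)
    (ht : τ ^ 2 ≤ t) (j : Fin p) : SigA j j ≤ 8 * t := by
  have h1 := integral_sq_le (h.measurable_A_apply ⟨0, hn⟩ j) ht0
    (hasSubgaussianMGF_mono (h.subG_A_apply ⟨0, hn⟩ j) ht)
  rw [← h.integral_A_mul_A ⟨0, hn⟩]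
  simpa only [sq] using h1

lemma measure_AA_le (h : AdditiveErrorModel μ X A ε SigA τ σ) (ht1 : 1 ≤ t) (ht : τ ^ 2 ≤ t)
    (hδ : 0 ≤ δ) (hδ1 : δ ≤ 1) (j k : Fin p) :
    μ.real {ω | n * δ ≤ |∑ i, (A ω i j * A ω i k - SigA j k)|} ≤
      2 * Real.exp (-(n * (δ ^ 2 / (8192 * t ^ 2)))) :=
  measure_sum_mul_sub_ge_le (fun i => h.measurable_A_apply i j) (fun i => h.measurable_A_apply i k)
    (h.indep_A.comp (fun _ r => (r j, r k)) fun _ => by fun_prop) ht1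
    (fun i => hasSubgaussianMGF_mono (h.subG_A_apply i j) ht)
    (fun i => hasSubgaussianMGF_mono (h.subG_A_apply i k) ht) (fun i => h.integral_A_mul_A i j k)
    hδ hδ1

lemma measure_XA_le (h : AdditiveErrorModel μ X A ε SigA τ σ) (hn : 0 < n) (ht1 : 1 ≤ t)
    (ht : τ ^ 2 ≤ t) (hδ : 0 ≤ δ) (j k : Fin p) :
    μ.real {ω | ∑ i, X ω i j ^ 2 ≤ n ∧ n * δ ≤ |∑ i, X ω i j * A ω i k|} ≤
      2 * Real.exp (-(n * (δ ^ 2 / (8192 * t ^ 2)))) := by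
  have hXA : IndepFun X A μ := h.indep_X.comp measurable_id measurable_fst
  have ht' : (1 : ℝ) ≤ t := ht1
  refine measure_le_of_indepFun h.measurable_X h.measurable_A hXA
    (S := {q | ∑ i, q.1 i j ^ 2 ≤ (n : ℝ) ∧ n * δ ≤ |∑ i, q.1 i j * q.2 i k|}) ?_ fun x => ?_
  · refine measurableSet_le_and_le ?_ ?_ ?_ ?_ <;> fun_prop
  · by_cases hx : ∑ i, x i j ^ 2 ≤ (n : ℝ)
    · have h1 := measure_abs_sum_mul_ge_le (B := 1)
        (h.indep_A.comp (fun _ r => r k) fun _ => by fun_prop)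
        (fun i => hasSubgaussianMGF_mono (h.subG_A_apply i k) ht) (x := fun i => x i j) (δ := δ)
        (by simpa using hx) (lt_of_lt_of_le one_pos ht1) one_pos hn hδ
      refine (measureReal_mono fun ω hω => hω.2).trans (h1.trans ?_)
      exact exp_neg_le_of_le (by positivity) (by push_cast; nlinarith) (Nat.cast_nonneg n)
    · have : {ω | (x, A ω) ∈ {q : (Fin n → Fin p → ℝ) × (Fin n → Fin p → ℝ) |
          ∑ i, q.1 i j ^ 2 ≤ (n : ℝ) ∧ n * δ ≤ |∑ i, q.1 i j * q.2 i k|}} = ∅ :=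
        Set.eq_empty_of_forall_notMem fun ω hω => hx hω.1
      rw [this, measureReal_empty]
      positivity

lemma measure_Zeps_le (h : AdditiveErrorModel μ X A ε SigA τ σ) (hn : 0 < n) (ht1 : 1 ≤ t)
    (ht : σ ^ 2 ≤ t) (hδ : 0 ≤ δ) (j : Fin p) :
    μ.real {ω | ∑ i, (X ω i j + A ω i j) ^ 2 ≤ n * (20 * t) ∧
        n * δ ≤ |∑ i, (X ω i j + A ω i j) * ε ω i|} ≤
      2 * Real.exp (-(n * (δ ^ 2 / (8192 * t ^ 2)))) := by
  have hind := indepFun_prodMk_of_indepFun h.measurable_X h.measurable_A h.measurable_eps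
    h.indep_X h.indep_A_eps
  have ht0 : 0 < t := lt_of_lt_of_le one_pos ht1
  refine measure_le_of_indepFun (h.measurable_X.prodMk h.measurable_A) h.measurable_eps hind
    (S := {q | ∑ i, (q.1.1 i j + q.1.2 i j) ^ 2 ≤ n * (20 * (t : ℝ)) ∧
      n * δ ≤ |∑ i, (q.1.1 i j + q.1.2 i j) * q.2 i|}) ?_ fun x => ?_
  · refine measurableSet_le_and_le ?_ ?_ ?_ ?_ <;> fun_prop
  · by_cases hx : ∑ i, (x.1 i j + x.2 i j) ^ 2 ≤ n * (20 * (t : ℝ))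
    · have h1 := measure_abs_sum_mul_ge_le (B := 20 * t) h.indep_eps
        (fun i => hasSubgaussianMGF_mono (h.subG_eps i) ht) (x := fun i => x.1 i j + x.2 i j)
        (δ := δ) (by push_cast; exact hx) ht0 (by positivity) hn hδ
      refine (measureReal_mono fun ω hω => hω.2).trans (h1.trans ?_)
      have : (0 : ℝ) < t := ht0
      exact exp_neg_le_of_le (by positivity) (by push_cast; nlinarith) (Nat.cast_nonneg n)
    · have : {ω | (x, ε ω) ∈ {q : ((Fin n → Fin p → ℝ) × (Fin n → Fin p → ℝ)) × (Fin n → ℝ) |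
          ∑ i, (q.1.1 i j + q.1.2 i j) ^ 2 ≤ n * (20 * (t : ℝ)) ∧
            n * δ ≤ |∑ i, (q.1.1 i j + q.1.2 i j) * q.2 i|}} = ∅ :=
        Set.eq_empty_of_forall_notMem fun ω hω => hx hω.1
      rw [this, measureReal_empty]
      positivity

/-- With high probability all entrywise deviations are at most `δ`. The deviations of `Aᵀ A`
also bound the columns of `Z`, which controls `Zᵀ ε` conditionally on `Z`. -/
theorem exists_deviation_event (h : AdditiveErrorModel μ X A ε SigA τ σ) (hn : 0 < n)
    (ht1 : 1 ≤ t) (hτ : τ ^ 2 ≤ t) (hσ : σ ^ 2 ≤ t) (hδ : 0 ≤ δ) (hδ1 : δ ≤ 1) :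
    ∃ E : Set Ω, MeasurableSet E ∧
      1 - 6 * (p : ℝ) ^ 2 * Real.exp (-(n * (δ ^ 2 / (8192 * t ^ 2)))) ≤ μ.real E ∧
      ∀ ω ∈ E, (∀ j, ∑ i, X ω i j ^ 2 ≤ (n : ℝ)) →
        (∀ j k, |∑ i, (A ω i j * A ω i k - SigA j k)| ≤ n * δ) ∧
        (∀ j k, |∑ i, X ω i j * A ω i k| ≤ n * δ) ∧
        ∀ j, |∑ i, (X ω i j + A ω i j) * ε ω i| ≤ n * δ := by
  have hmX := h.measurable_X
  have hmA := h.measurable_A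
  have hmε := h.measurable_eps
  set r := Real.exp (-(n * (δ ^ 2 / (8192 * t ^ 2)))) with hr
  set BA : Fin p → Fin p → Set Ω := fun j k =>
    {ω | n * δ ≤ |∑ i, (A ω i j * A ω i k - SigA j k)|} with hBA
  set BX : Fin p → Fin p → Set Ω := fun j k =>
    {ω | ∑ i, X ω i j ^ 2 ≤ n ∧ n * δ ≤ |∑ i, X ω i j * A ω i k|} with hBX
  set BZ : Fin p → Set Ω := fun j => {ω | ∑ i, (X ω i j + A ω i j) ^ 2 ≤ n * (20 * t) ∧
    n * δ ≤ |∑ i, (X ω i j + A ω i j) * ε ω i|} with hBZ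
  set bad : Fin p × Fin p → Set Ω := fun q => (BA q.1 q.2 ∪ BX q.1 q.2) ∪ BZ q.1 with hbad
  have hmeas : ∀ q, MeasurableSet (bad q) := fun q => by
    refine MeasurableSet.union (MeasurableSet.union ?_ ?_) ?_
    · refine measurableSet_le ?_ ?_ <;> fun_prop
    · refine measurableSet_le_and_le ?_ ?_ ?_ ?_ <;> fun_prop
    · refine measurableSet_le_and_le ?_ ?_ ?_ ?_ <;> fun_prop
  have hbound : ∀ q, μ.real (bad q) ≤ 6 * r := fun q => by
    have h1 := h.measure_AA_le ht1 hτ hδ hδ1 q.1 q.2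
    have h2 := h.measure_XA_le hn ht1 hτ hδ q.1 q.2
    have h3 := h.measure_Zeps_le hn ht1 hσ hδ q.1
    have h4 : μ.real (bad q) ≤ μ.real (BA q.1 q.2) + μ.real (BX q.1 q.2) + μ.real (BZ q.1) :=
      (measureReal_union_le _ _).trans (add_le_add_left (measureReal_union_le _ _) _)
    linarith
  have hmU : MeasurableSet (⋃ q, bad q) := MeasurableSet.iUnion hmeas
  refine ⟨(⋃ q, bad q)ᶜ, hmU.compl, ?_, fun ω hω hX => ?_⟩
  · rw [probReal_compl_eq_one_sub hmU]
    have h1 : μ.real (⋃ q, bad q) ≤ ∑ q, μ.real (bad q) := measureReal_iUnion_fintype_le _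
    have h2 : ∑ q, μ.real (bad q) ≤ ∑ _q : Fin p × Fin p, 6 * r :=
      Finset.sum_le_sum fun q _ => hbound q
    rw [Finset.sum_const, Finset.card_univ, Fintype.card_prod, Fintype.card_fin,
      nsmul_eq_mul] at h2
    push_cast at h2
    nlinarith
  · have hnot : ∀ j k, ω ∉ BA j k ∧ ω ∉ BX j k ∧ ω ∉ BZ j := fun j k => by
      have h1 : ω ∉ bad (j, k) := fun h' => hω (Set.mem_iUnion.2 ⟨_, h'⟩)
      exact ⟨fun h' => h1 (Or.inl (Or.inl h')), fun h' => h1 (Or.inl (Or.inr h')),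
        fun h' => h1 (Or.inr h')⟩
    have hA : ∀ j k, |∑ i, (A ω i j * A ω i k - SigA j k)| ≤ n * δ := fun j k =>
      le_of_not_ge (hnot j k).1
    refine ⟨hA, fun j k => ?_, fun j => ?_⟩
    · exact le_of_not_ge fun h' => (hnot j k).2.1 ⟨hX j, h'⟩
    · refine le_of_not_ge fun h' => (hnot j j).2.2 ⟨?_, h'⟩
      have h1 := (abs_le.1 (hA j j)).2
      rw [Finset.sum_sub_distrib, Finset.sum_const, Finset.card_univ, Fintype.card_fin,
        nsmul_eq_mul] at h1
      have ht' : (1 : ℝ) ≤ t := ht1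
      have h2 := h.SigA_diag_le hn (lt_of_lt_of_le one_pos ht1) hτ j
      have h3 : ∑ i, (X ω i j + A ω i j) ^ 2 ≤
          2 * ∑ i, X ω i j ^ 2 + 2 * ∑ i, A ω i j * A ω i j := by
        rw [Finset.mul_sum, Finset.mul_sum, ← Finset.sum_add_distrib]
        exact Finset.sum_le_sum fun i _ => by nlinarith [sq_nonneg (X ω i j - A ω i j)]
      have h4 : SigA j j + δ ≤ 9 * t := by linarith
      have h5 : (n : ℝ) * (SigA j j + δ) ≤ n * (9 * t) := by gcongr
      have h6 : (n : ℝ) * 1 ≤ n * t := by gcongr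
      linarith [hX j]

end AdditiveErrorModel

end Model

/-! ### The rate -/

lemma tsum_abs_padZero {p : ℕ} (b : Fin p → ℝ) : ∑' i, |padZero b i| = l1Norm b := by
  rw [tsum_eq_sum (s := Finset.range p), Finset.sum_range, l1Norm]
  · exact Finset.sum_congr rfl fun i _ => by simp [padZero]
  · intro i hi
    simp [padZero, Finset.mem_range.not.1 hi]

/-- `s` times the entrywise deviation that the restricted eigenvalue constant `κ`, the largest
eigenvalue `l` of `Σ_A` and the norm of the signal `b` leave room for. -/
noncomputable def tolerance (b : ℕ → ℝ) (κ l : ℝ) : ℝ :=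
  min (min 1 (κ / 144)) (min (l / 4) (l / 4 * ∑' i, |b i|))

/-- The constant in the exponent of the tail probability; the value `1` is used for arguments
at which the tolerance is not positive, which the model excludes. -/
noncomputable def rate (b : ℕ → ℝ) (t u κ l : ℝ) : ℝ :=
  if 0 < tolerance b κ l then 8192 * (1 + |t| + |u|) ^ 2 / tolerance b κ l ^ 2 else 1

lemma rate_pos (b : ℕ → ℝ) (t u κ l : ℝ) : 0 < rate b t u κ l := by
  rw [rate]
  split_ifs with h
  · positivity
  · exact one_pos

end CaZnRLS

open CaZnRLS in
theorem corollary2 :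
    ∃ C c : ℝ, 0 < C ∧ 0 < c ∧
    ∃ ζ : (ℕ → ℝ) → ℝ → ℝ → ℝ → ℝ → ℝ, (∀ b t u v l, 0 < ζ b t u v l) ∧
    ∀ {Ω : Type*} [MeasurableSpace Ω] (μ : Measure Ω) [IsProbabilityMeasure μ] (n p : ℕ)
      (X A : Ω → Fin n → Fin p → ℝ) (ε : Ω → Fin n → ℝ) (βstar : Fin p → ℝ)
      (SigA : Matrix (Fin p) (Fin p) ℝ) (τ σ : ℝ≥0) (κ e : ℝ),
      AdditiveErrorModel μ X A ε SigA τ σ →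
      0 < σ → 0 < lamMax SigA → βstar ≠ 0 → 0 < e →
      (∀ᵐ ω ∂μ, REC (gram (Matrix.of (X ω))) (supp βstar) κ) →
      ∃ E : Set Ω, MeasurableSet E ∧
        1 - C * (p : ℝ) ^ 2 * Real.exp (-(c * (n : ℝ) * ((nnz βstar : ℝ) ^ 2)⁻¹ *
          (ζ (padZero βstar) ((τ : ℝ) ^ 2) ((σ : ℝ) ^ 2) κ (lamMax SigA))⁻¹)) ≤ μ.real E ∧
        ∀ ω ∈ E,
          let Sh := sigHat (Matrix.of (X ω)) (Matrix.of (A ω)) SigA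
          let ξh := xiHat (Matrix.of (X ω)) (Matrix.of (A ω)) (ε ω) βstar
          let Zt := calZ n Sh e
          let yt := calY n Sh e ξh
          let K := constK SigA e βstar
          ∀ (a lam : ℝ) (w β : ℕ → Fin p → ℝ) (ρ : ℕ → ℝ) (βLS : Fin p → ℝ),
            IsRun n Zt yt a lam w β ρ →
            IsOracleLS n Zt yt (supp βstar) βLS →
            6 * constK' K (calibrated Sh e) βstar ≤ lam →
            max (4 * a / ((a + 1) * minAbs βstar))
              (5 * κ * constK'' K (calibrated Sh e) βstar / (8 * lam)) < ρ 1 →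
            ρ 3 ≤ √(5 * κ / (18 * √3 * lam)) →
            ∀ k : ℕ, kHat (nnz βstar) κ lam (ρ 3) + 1 ≤ k →
              β k = βLS ∧ ∀ i, SignType.sign (β k i) = SignType.sign (βstar i) := by
  refine ⟨6, 1, by norm_num, one_pos, rate, rate_pos, ?_⟩
  intro Ω _ μ _ n p X A ε βstar SigA τ σ κ e h _ hl hβ he hREC
  obtain ⟨i₀, hi₀⟩ := Function.ne_iff.1 hβ
  rw [Pi.zero_apply] at hi₀
  -- without observations the cone condition fails at `β*` itself
  have hn : 0 < n := by
    obtain ⟨ω, hω⟩ := hREC.exists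
    rcases Nat.eq_zero_or_pos n with rfl | hn
    · have hcone : βstar ∈ cone (supp βstar) := by
        refine ⟨supp βstar, subset_rfl, ?_, ?_⟩
        · linarith [Nat.cast_nonneg (α := ℝ) (supp βstar).card]
        · rw [Finset.sum_eq_zero fun i hi => ?_]
          · positivity
          · have : βstar i = 0 := by simpa [mem_supp] using hi
            rw [this, abs_zero]
      have h1 := hω.2 βstar hcone
      have h2 : 0 < ∑ i, βstar i ^ 2 :=
        Finset.sum_pos' (fun _ _ => sq_nonneg _) ⟨i₀, Finset.mem_univ _, by positivity⟩
      simp [CaZnRLS.gram] at h1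
      nlinarith [hω.1]
    · exact hn
  have hκ : 0 < κ := hREC.exists.choose_spec.1
  have hl1 : 0 < l1Norm βstar :=
    Finset.sum_pos' (fun _ _ => abs_nonneg _) ⟨i₀, Finset.mem_univ _, by positivity⟩
  have hs : 0 < nnz βstar := Finset.card_pos.2 ⟨i₀, mem_supp.2 hi₀⟩
  have hs1 : (1 : ℝ) ≤ nnz βstar := by exact_mod_cast hs
  set D := tolerance (padZero βstar) κ (lamMax SigA) with hD
  have hDeq : D = min (min 1 (κ / 144))
      (min (lamMax SigA / 4) (lamMax SigA / 4 * l1Norm βstar)) := by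
    rw [hD, tolerance, tsum_abs_padZero]
  have hD0 : 0 < D := by rw [hDeq]; positivity
  have hDone : D ≤ 1 := by rw [hDeq]; exact (min_le_left _ _).trans (min_le_left _ _)
  have hDκ : D ≤ κ / 144 := by rw [hDeq]; exact (min_le_left _ _).trans (min_le_right _ _)
  have hDl : D ≤ lamMax SigA / 4 := by
    rw [hDeq]; exact (min_le_right _ _).trans (min_le_left _ _)
  have hDb : D ≤ lamMax SigA / 4 * l1Norm βstar := by
    rw [hDeq]; exact (min_le_right _ _).trans (min_le_right _ _)
  set δ := D / nnz βstar with hδ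
  have hδD : δ ≤ D := div_le_self hD0.le hs1
  have hδ0 : 0 < δ := by positivity
  set t : ℝ≥0 := 1 + τ ^ 2 + σ ^ 2 with ht
  obtain ⟨E, hE, hprob, hgood⟩ := h.exists_deviation_event hn (t := t) (δ := δ)
    (by rw [ht, add_assoc]; exact le_self_add)
    (by rw [ht, add_comm 1, add_assoc]; exact le_self_add)
    (by rw [ht]; exact le_add_self) hδ0.le (hδD.trans hDone)
  -- a measurable set of full measure on which the almost sure assumptions hold
  have hae := h.normalized_X.and hREC
  rw [ae_iff] at hae
  set N := toMeasurable μ {ω | ¬((∀ j, ∑ i, X ω i j ^ 2 ≤ (n : ℝ)) ∧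
    REC (gram (Matrix.of (X ω))) (supp βstar) κ)} with hN
  have hN0 : μ N = 0 := by rw [hN, measure_toMeasurable, hae]
  have hNm : MeasurableSet N := measurableSet_toMeasurable _ _
  refine ⟨E \ N, hE.diff hNm, ?_, ?_⟩
  · have h1 : μ.real (E \ N) = μ.real E := by
      rw [measureReal_def, measureReal_def, measure_sdiff_null hN0]
    rw [h1, rate, if_pos hD0]
    refine le_trans (le_of_eq ?_) hprob
    rw [← hD, abs_of_nonneg (sq_nonneg _), abs_of_nonneg (sq_nonneg _), hδ, ht]
    congr 3
    push_cast
    have : (nnz βstar : ℝ) ≠ 0 := by positivity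
    field_simp
  · intro ω hω Sh ξh Zt yt K a lam w β ρ βLS hrun hLS hlam hρ1 hρ3 k hk
    have hωN : (∀ j, ∑ i, X ω i j ^ 2 ≤ (n : ℝ)) ∧
        REC (gram (Matrix.of (X ω))) (supp βstar) κ := by
      by_contra hc
      exact hω.2 (subset_toMeasurable _ _ hc)
    obtain ⟨hAA, hXA, hZε⟩ := hgood ω hω.1 hωN.1
    have hSig := h.isSelfAdjoint_SigA hn
    have hSh : IsSelfAdjoint Sh := sigHat_isSelfAdjoint _ _ hSig
    refine run_eq_oracle (M := calibrated Sh e) (ξ := ξh) (lsLoss_cal_add hn hSh he ξh) he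
      (fun v => ?_) hβ hκ (fun u hu => ?_) (fun i => ?_) hrun hLS hlam hρ1 hρ3 hk
    · rw [← dotProduct_algebraMap_mulVec]
      exact dotProduct_mulVec_mono (algebraMap_le_calibrated hSh e) v
    · refine calibrated_restricted_eigenvalue hn hSig e hδ0.le ?_ hωN.2 hAA hXA hu
      have : ((supp βstar).card : ℝ) * δ = D := by
        rw [hδ, ← nnz]; field_simp
      linarith
    · exact abs_xiHat_sub_calibrated_le hn hSig he.le hl.le (hδD.trans hDl) (hδD.trans hDb)
        hAA hXA hZε i
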